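/- **Theorem (convergence of asynchronous stochastic approximation).** Let $d\ge 1$, $\mathcal I=\{1,\dots,d\}$, let $\|\cdot\|$ be the infinity norm on $\mathbb R^d$, let $h:\mathbb R^d\to\mathbb R^d$, and let $\alpha_n>0$, $n\ge 0$. On a probability space with a filtration $\{\mathcal F_n\}_{n\ge0}$, let $x_n, M_n,\epsilon_n$ ($\mathbb R^d$-valued) and $Y_n$ (nonempty subsets of $\mathcal I$) be $\mathcal F_n$-measurable for each $n$. Put $\nu(n,i)=\sum_{k=0}^{n-1}\mathbf 1\{i\in Y_k\}$ and suppose that for all $n\ge0$, $x_{n+1}(i)=x_n(i)$ for $i\notin Y_n$, and $$x_{n+1}(i)=x_n(i)+\alpha_{\nu(n,i)}\big(h_i(x_n)+M_{n+1}(i)+\epsilon_{n+1}(i)\big)\quad\text{for } i\in Y_n .$$ Assume: 1. (Function $h$.) $h$ is Lipschitz continuous; as $c\uparrow\infty$, $h_c(x)=h(cx)/c$ converges uniformly on compact sets to some $h_\infty:\mathbb R^d\to\mathbb R^d$; and the origin is the unique globally asymptotically stable equilibrium of $\dot x=h_\infty(x)$. 2. (Noise.) For all $n\ge 0$: $\mathbb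 E\|M_{n+1}\|<\infty$, $\mathbb E[M_{n+1}\mid\mathcal F_n]=0$ and $\mathbb E[\|M_{n+1}\|^2\mid\mathcal F_n]\le K_n(1+\|x_n\|^2)$ a.s., where $K_n\ge0$ is $\mathcal F_n$-measurable and $\sup_nK_n<\infty$ a.s.; and $\|\epsilon_{n+1}\|\le\delta_{n+1}(1+\|x_n\|)$ a.s., where $\delta_{n+1}$ is $\mathcal F_{n+1}$-measurable and $\delta_n\to0$ a.s. 3. (Stepsizes.) $\sum_n\alpha_n=\infty$, $\sum_n\alpha_n^2<\infty$, and $\alpha_{n+1}\le\alpha_n$ for all large $n$; for each $x\in(0,1)$, $\sup_n\alpha_{[xn]}/\alpha_n<\infty$; and for each $x\in(0,1)$, $\sum_{k=0}^{[yn]}\alpha_k\big/\sum_{k=0}^n\alpha_k\to1$ as $n\to\infty$, uniformly in $y\in[x,1]$. Here $[\cdot]$ is the integral part. 4. (Asynchrony.) For some deterministic $\Delta>0$, $\liminf_{n\to\infty}\nu(n,i)/n\ge\Delta$ a.s. for all $i\in\mathcal I$; and, with $N(n,x)=\min\{m>n:\sum_{k=n}^m\alpha_k\ge x\}$, for each $x>0$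 and all $i,j\in\mathcal I$ the limit $$\lim_{n\to\infty}\frac{\sum_{k=\nu(n,i)}^{\nu(N(n,x),i)}\alpha_k}{\sum_{k=\nu(n,j)}^{\nu(N(n,x),j)}\alpha_k}$$ exists a.s. Let $\tilde\alpha_n=\sum_{i\in Y_n}\alpha_{\nu(n,i)}$ and $\tilde t(n)=\sum_{k=0}^{n-1}\tilde\alpha_k$, and let $\bar x:\mathbb R\to\mathbb R^d$ be given by $\bar x(t)=x_0$ for $t<0$ and $$\bar x(t)=x_n+\frac{t-\tilde t(n)}{\tilde t(n+1)-\tilde t(n)}(x_{n+1}-x_n),\qquad t\in[\tilde t(n),\tilde t(n+1)],\ n\ge0 .$$ Then almost surely there is a (possibly sample path-dependent) nonempty set $D\subset\mathbb R^d$ such that: (i) $D$ is compact and connected, and it is invariant and internally chain transitive for $\dot x(t)=h(x(t))$; and $x_n$ converges to $D$, i.e. $\operatorname{dist}(x_n,D)\to0$. (ii) $\bar x$ is continuous, the family of shifts $\{\bar x(t+\cdot)\}_{t\in\mathbb R}$ is relatively compact in $C(\mathbb R;\mathbb R^d)$ with the topology of uniform convergence on compact intervals, and every limit point of $\bar x(t+\cdot)$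 as $t\to\infty$ is a solution on $\mathbb R$ of $\dot x(t)=\frac1d h(x(t))$ that remains entirely in $D$. Here $D$ is *invariant* if every solution with $x(0)\in D$ satisfies $x(t)\in D$ for all $t\in\mathbb R$, and *internally chain transitive* if for all $a,b\in D$, $\varepsilon>0$, $T>0$ there are $n\ge1$ and points $p_0=a,p_1,\dots,p_n=b$ in $D$ such that, for each $0\le i<n$, the solution starting at $p_i$ is within distance less than $\varepsilon$ of $p_{i+1}$ at some time $t\ge T$. -/

import Mathlib

open MeasureTheory ProbabilityTheory Filter Topology Set

noncomputable section

namespace AsyncSA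

/-! ### Autonomous differential equations

The state space is `Fin d → ℝ`, whose norm is the infinity norm. A solution of `ẋ(t) = f (x(t))`
on all of `ℝ` is `IsIntegralCurve x (fun _ => f)`; a solution on `[0, ∞)` is
`IsIntegralCurveOn x (fun _ => f) (Ici 0)`. -/

/-- The origin is a globally asymptotically stable equilibrium of `ẋ = f x`: it is an equilibrium,
it is Lyapunov stable, and it attracts every solution. (It is then the only equilibrium.) -/
structure IsGASOrigin {d : ℕ} (f : (Fin d → ℝ) → (Fin d → ℝ)) : Prop where
  equilibrium : f 0 = 0
  stable : ∀ ε > 0, ∃ δ > 0, ∀ x : ℝ → Fin d → ℝ, IsIntegralCurveOn x (fun _ => f) (Ici 0) →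
    ‖x 0‖ < δ → ∀ t ≥ 0, ‖x t‖ < ε
  attractive : ∀ x : ℝ → Fin d → ℝ, IsIntegralCurveOn x (fun _ => f) (Ici 0) →
    Tendsto x atTop (𝓝 0)

/-- `D` is invariant for `ẋ = f x`: a solution that starts in `D` is in `D` at all times `t ∈ ℝ`. -/
def IsInvariantSet {d : ℕ} (f : (Fin d → ℝ) → (Fin d → ℝ)) (D : Set (Fin d → ℝ)) : Prop :=
  ∀ x : ℝ → Fin d → ℝ, IsIntegralCurve x (fun _ => f) → x 0 ∈ D → ∀ t, x t ∈ D

/-- `D` is internally chain transitive for `ẋ = f x`: for all `a, b ∈ D`, `ε > 0` and `T > 0` there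
are `n ≥ 1` and points `p 0 = a, p 1, …, p n = b` of `D` such that for every `i < n` the solution
that starts at `p i` meets the `ε`-neighbourhood of `p (i + 1)` at some time `t ≥ T`. -/
def IsInternallyChainTransitive {d : ℕ} (f : (Fin d → ℝ) → (Fin d → ℝ))
    (D : Set (Fin d → ℝ)) : Prop :=
  ∀ a ∈ D, ∀ b ∈ D, ∀ ε > 0, ∀ T > 0, ∃ n ≥ 1, ∃ p : ℕ → Fin d → ℝ,
    p 0 = a ∧ p n = b ∧ (∀ i ≤ n, p i ∈ D) ∧
    ∀ i < n, ∃ x : ℝ → Fin d → ℝ, IsIntegralCurve x (fun _ => f) ∧ x 0 = p i ∧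
      ∃ t ≥ T, ‖x t - p (i + 1)‖ < ε

/-! ### Conditions on the drift `h` -/

/-- The Borkar–Meyn stability criterion: `h` is Lipschitz, the functions `h_c(x) = h(cx)/c` converge
uniformly on compact sets to some `h_∞` as `c → ∞`, and the origin is globally asymptotically
stable for `ẋ = h_∞(x)`. -/
structure DriftConditions {d : ℕ} (h : (Fin d → ℝ) → (Fin d → ℝ)) : Prop where
  lipschitz : ∃ L : NNReal, LipschitzWith L h
  scaling : ∃ hinf : (Fin d → ℝ) → (Fin d → ℝ),
    (∀ S : Set (Fin d → ℝ), IsCompact S →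
      TendstoUniformlyOn (fun (c : ℝ) y => c⁻¹ • h (c • y)) hinf atTop S) ∧
    IsGASOrigin hinf

/-! ### Conditions on the stepsizes -/

structure StepsizeConditions (α : ℕ → ℝ) : Prop where
  pos : ∀ n, 0 < α n
  not_summable : ¬ Summable α
  summable_sq : Summable (fun n => α n ^ 2)
  eventually_nonincreasing : ∀ᶠ n in atTop, α (n + 1) ≤ α n
  ratio_bdd : ∀ x ∈ Ioo (0 : ℝ) 1, BddAbove (range fun n : ℕ => α ⌊x * n⌋₊ / α n)
  partial_sums : ∀ x ∈ Ioo (0 : ℝ) 1,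
    TendstoUniformlyOn
      (fun (n : ℕ) (y : ℝ) =>
        (∑ k ∈ Finset.range (⌊y * n⌋₊ + 1), α k) / ∑ k ∈ Finset.range (n + 1), α k)
      (fun _ => 1) atTop (Icc x 1)

/-! ### The asynchronous updates -/

/-- `ν(n, i)`: the number of updates of component `i` before iteration `n`, when the components
in `Y k` are updated at iteration `k`. -/
def updateCount {d : ℕ} (Y : ℕ → Finset (Fin d)) (n : ℕ) (i : Fin d) : ℕ :=
  ((Finset.range n).filter fun k => i ∈ Y k).card

/-- `N(n, x) = min {m > n : ∑_{k = n}^m α_k ≥ x}`. -/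
def windowEnd (α : ℕ → ℝ) (n : ℕ) (x : ℝ) : ℕ :=
  sInf {m : ℕ | n < m ∧ x ≤ ∑ k ∈ Finset.Icc n m, α k}

structure UpdateConditions {Ω : Type*} {m0 : MeasurableSpace Ω} {d : ℕ} (μ : Measure Ω)
    (α : ℕ → ℝ) (Y : ℕ → Ω → Finset (Fin d)) : Prop where
  frequency : ∃ Δ > (0 : ℝ), ∀ i : Fin d, ∀ᵐ ω ∂μ,
    Δ ≤ liminf (fun n : ℕ => (updateCount (fun k => Y k ω) n i : ℝ) / n) atTop
  balance : ∀ x > (0 : ℝ), ∀ i j : Fin d, ∀ᵐ ω ∂μ, ∃ l : ℝ,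
    Tendsto
      (fun n : ℕ =>
        (∑ k ∈ Finset.Icc (updateCount (fun k => Y k ω) n i)
            (updateCount (fun k => Y k ω) (windowEnd α n x) i), α k) /
        ∑ k ∈ Finset.Icc (updateCount (fun k => Y k ω) n j)
            (updateCount (fun k => Y k ω) (windowEnd α n x) j), α k)
      atTop (𝓝 l)

/-! ### The algorithm and its noise -/

/-- The asynchronous stochastic approximation algorithm, together with the filtration `ℱ` it is
adapted to. `M 0` and `ε 0` play no role in the recursion. -/
structure IsAsyncSA {Ω : Type*} {m0 : MeasurableSpace Ω} {d : ℕ} (ℱ : Filtration ℕ m0)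
    (h : (Fin d → ℝ) → (Fin d → ℝ)) (α : ℕ → ℝ) (Y : ℕ → Ω → Finset (Fin d))
    (x M ε : ℕ → Ω → Fin d → ℝ) : Prop where
  nonempty : ∀ n ω, (Y n ω).Nonempty
  update : ∀ n ω, ∀ i ∈ Y n ω, x (n + 1) ω i =
    x n ω i + α (updateCount (fun k => Y k ω) n i) *
      (h (x n ω) i + M (n + 1) ω i + ε (n + 1) ω i)
  no_update : ∀ n ω, ∀ i ∉ Y n ω, x (n + 1) ω i = x n ω i
  adapted_x : Adapted ℱ x
  adapted_Y : ∀ n i, MeasurableSet[ℱ n] {ω | i ∈ Y n ω}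
  adapted_M : Adapted ℱ M
  adapted_ε : Adapted ℱ ε

/-- Conditions on the centered noise `M` and the biased noise `ε`. The conditional second moment is
the conditional expectation of a nonnegative, possibly non-integrable random variable, hence the
`[0, ∞]`-valued `condLExp`. -/
structure NoiseConditions {Ω : Type*} {m0 : MeasurableSpace Ω} {d : ℕ} (μ : Measure Ω)
    (ℱ : Filtration ℕ m0) (x M ε : ℕ → Ω → Fin d → ℝ) : Prop where
  integrable : ∀ n, Integrable (M (n + 1)) μ
  centered : ∀ n, condExp (ℱ n) μ (M (n + 1)) =ᵐ[μ] 0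
  variance : ∃ K : ℕ → Ω → ℝ, Adapted ℱ K ∧ (∀ n ω, 0 ≤ K n ω) ∧
    (∀ᵐ ω ∂μ, BddAbove (range fun n => K n ω)) ∧
    ∀ n, ∀ᵐ ω ∂μ, condLExp (ℱ n) μ (fun ω' => ENNReal.ofReal (‖M (n + 1) ω'‖ ^ 2)) ω ≤
      ENNReal.ofReal (K n ω * (1 + ‖x n ω‖ ^ 2))
  bias : ∃ δ : ℕ → Ω → ℝ, (∀ n, Measurable[ℱ (n + 1)] (δ (n + 1))) ∧
    (∀ᵐ ω ∂μ, Tendsto (fun n => δ n ω) atTop (𝓝 0)) ∧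
    ∀ n, ∀ᵐ ω ∂μ, ‖ε (n + 1) ω‖ ≤ δ (n + 1) ω * (1 + ‖x n ω‖)

/-! ### The interpolated trajectory (for a fixed sample path) -/

/-- The aggregated stepsize `∑_{i ∈ Y n} α_{ν(n, i)}`. -/
def aggStep {d : ℕ} (α : ℕ → ℝ) (Y : ℕ → Finset (Fin d)) (n : ℕ) : ℝ :=
  ∑ i ∈ Y n, α (updateCount Y n i)

/-- The time `∑_{k < n} aggStep k` at which the trajectory is at the `n`-th iterate. -/
def aggTime {d : ℕ} (α : ℕ → ℝ) (Y : ℕ → Finset (Fin d)) (n : ℕ) : ℝ :=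
  ∑ k ∈ Finset.range n, aggStep α Y k

/-- For `t ≥ 0`, the index `n` with `aggTime n ≤ t < aggTime (n + 1)`. -/
def segmentIndex {d : ℕ} (α : ℕ → ℝ) (Y : ℕ → Finset (Fin d)) (t : ℝ) : ℕ :=
  sInf {n : ℕ | t < aggTime α Y (n + 1)}

/-- The piecewise linear trajectory that is at `x n` at time `aggTime n`, equal to `x 0` before
time `0`. -/
def interp {d : ℕ} (α : ℕ → ℝ) (Y : ℕ → Finset (Fin d)) (x : ℕ → Fin d → ℝ) (t : ℝ) :
    Fin d → ℝ :=
  if t < 0 then x 0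
  else
    let n := segmentIndex α Y t
    x n + ((t - aggTime α Y n) / (aggTime α Y (n + 1) - aggTime α Y n)) • (x (n + 1) - x n)

/-- The shift `X(t + ·)` in `C(ℝ, ℝ^d)`, which carries the topology of uniform convergence on
compact sets. -/
def shift {d : ℕ} (X : C(ℝ, Fin d → ℝ)) (t : ℝ) : C(ℝ, Fin d → ℝ) :=
  ⟨fun s => X (t + s), by fun_prop⟩

end AsyncSA

end

open MeasureTheory ProbabilityTheory Filter Topology Set

noncomputable section

namespace AsyncSA

/-! ### Flows of Lipschitz vector fields -/

section Flow

variable {d : ℕ} {f : (Fin d → ℝ) → (Fin d → ℝ)} {L : NNReal}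

/-! In the time scale of the aggregated stepsizes the algorithm is a noisy Euler scheme for `ẋ =
h(x)/d`, provided that over bounded stretches the clock of each component (the sum of its own
stepsizes) advances by `1/d` of the common clock. The balance condition only says that the
increments of two component clocks over windows have a ratio tending to some `l`. But the clock of
component `i` at iteration `n` is the sum of the first `ν(n, i)` stepsizes with `ν(n, i) ≥ x n`
eventually, so the partial-sum condition makes it asymptotic to `∑_{k<n} α_k`. Averaging over
consecutive windows then forces `l = 1` (`eq_one_of_window_proportional`). Short windows and a
Lipschitz bound inside them yield `RegularUpdates.eventually_compTime_sub`.

The deterministic core is `norm_sub_solution_le`, a discrete Grönwall estimate in which noise and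
clock discrepancies enter only through their partial sums. It serves twice: for stability, with the
rescaled drift compared to `h_∞`, and for convergence, with `h` itself.

Stability (`exists_normalization`, `ae_bounded`) is delicate because the conditional variance of the
noise grows with the iterate, which is not yet known to be bounded. The noise is therefore divided
by an adapted normalizer `ρ`, reset to `max R ‖x‖` after each stretch of length `T`, and switched
off while `‖x‖ > B ρ`. Its conditional variance is then almost surely bounded, so truncation and L²
martingale convergence make the weighted sums converge. At late times `x/ρ` consequently tracks the
flow of `h_∞`, the switch never acts, and asymptotic stability brings `‖x‖/ρ` below `1/2` at the
next reset. So the normalizers stop increasing and the iterates are bounded.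

For bounded iterates the unweighted noise sums converge too, and the interpolation is an asymptotic
pseudotrajectory of the flow of `h/d`. Its limit set is compact, connected, invariant and internally
chain transitive, and is the set `D`; the factor `1/d` only changes the speed along orbits.
Arzelà–Ascoli handles the shifts. -/

lemma IsIntegralCurve.neg_time {x : ℝ → Fin d → ℝ} (hx : IsIntegralCurve x (fun _ => f)) :
    IsIntegralCurve (fun t => x (-t)) (fun _ y => -f y) := by
  intro t
  have := HasDerivAt.scomp t (hx (-t)) (hasDerivAt_neg t)
  simpa [Function.comp_def] using this

/-- Two solutions diverge at most exponentially fast, in both time directions. -/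
lemma norm_sub_le_of_isIntegralCurve (hf : LipschitzWith L f) {x y : ℝ → Fin d → ℝ}
    (hx : IsIntegralCurve x (fun _ => f)) (hy : IsIntegralCurve y (fun _ => f)) (t : ℝ) :
    ‖x t - y t‖ ≤ ‖x 0 - y 0‖ * Real.exp (L * |t|) := by
  have fwd : ∀ {g : (Fin d → ℝ) → (Fin d → ℝ)} {x y : ℝ → Fin d → ℝ}, LipschitzWith L g →
      IsIntegralCurve x (fun _ => g) → IsIntegralCurve y (fun _ => g) → ∀ t, 0 ≤ t →
      ‖x t - y t‖ ≤ ‖x 0 - y 0‖ * Real.exp (L * t) := by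
    intro g x y hg hx hy t ht
    have := dist_le_of_trajectories_ODE (v := fun _ => g) (f := x) (g := y) (a := 0) (b := t)
      (δ := ‖x 0 - y 0‖) (fun _ => hg) hx.continuous.continuousOn
      (fun s _ => (hx s).hasDerivWithinAt) hy.continuous.continuousOn
      (fun s _ => (hy s).hasDerivWithinAt) (dist_eq_norm _ _).le t ⟨ht, le_rfl⟩
    simpa [dist_eq_norm] using this
  rcases le_total 0 t with ht | ht
  · rw [abs_of_nonneg ht]; exact fwd hf hx hy t ht
  · have := fwd hf.neg (IsIntegralCurve.neg_time hx) (IsIntegralCurve.neg_time hy) (-t)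
      (by linarith)
    simpa [abs_of_nonpos ht] using this

lemma isIntegralCurve_unique (hf : LipschitzWith L f) {x y : ℝ → Fin d → ℝ}
    (hx : IsIntegralCurve x (fun _ => f)) (hy : IsIntegralCurve y (fun _ => f))
    (h0 : x 0 = y 0) : x = y := by
  funext t
  have := norm_sub_le_of_isIntegralCurve hf hx hy t
  rw [h0, sub_self, norm_zero, zero_mul] at this
  exact sub_eq_zero.mp (norm_le_zero_iff.mp this)

/-- Coordinatewise truncation to `[-R, R]`. -/
def clampBox (R : ℝ) (y : Fin d → ℝ) : Fin d → ℝ := fun i => max (-R) (min R (y i))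

lemma lipschitzWith_clampBox (R : ℝ) : LipschitzWith 1 (clampBox (d := d) R) := by
  refine LipschitzWith.of_dist_le_mul fun x y => ?_
  rw [NNReal.coe_one, one_mul, dist_pi_le_iff dist_nonneg]
  intro i
  refine le_trans ?_ (dist_le_pi_dist x y i)
  simp only [clampBox, Real.dist_eq]
  grind [abs_le]

lemma norm_clampBox_le {R : ℝ} (hR : 0 ≤ R) (y : Fin d → ℝ) : ‖clampBox R y‖ ≤ R := by
  rw [pi_norm_le_iff_of_nonneg hR]
  intro i
  simp only [clampBox, Real.norm_eq_abs]
  grind [abs_le]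

lemma clampBox_eq_self {R : ℝ} {y : Fin d → ℝ} (hy : ‖y‖ ≤ R) : clampBox R y = y := by
  funext i
  have := (norm_le_pi_norm y i).trans hy
  rw [Real.norm_eq_abs, abs_le] at this
  simp [clampBox, this.1, this.2]

lemma norm_le_of_lipschitzWith (hf : LipschitzWith L f) (y : Fin d → ℝ) :
    ‖f y‖ ≤ L * ‖y‖ + ‖f 0‖ := by
  have h1 := hf.norm_sub_le y 0
  have h2 := norm_le_norm_sub_add (f y) (f 0)
  rw [sub_zero] at h1
  linarith

/-- Picard–Lindelöf reaches a prescribed interval when the field is bounded, so `f` is first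
truncated outside the box of radius `R`. Grönwall's inequality, applied in both time directions,
keeps the truncated solution in that box, where the truncation has no effect. -/
lemma exists_solution_Ioo (hf : LipschitzWith L f) (p : Fin d → ℝ) {T : ℝ} (hT : 0 ≤ T) :
    ∃ γ : ℝ → Fin d → ℝ, γ 0 = p ∧ ∀ t ∈ Ioo (-T) T, HasDerivAt γ (f (γ t)) t := by
  set R : ℝ := gronwallBound ‖p‖ L ‖f 0‖ T with hRdef
  have hmono := gronwallBound_mono (norm_nonneg p) (norm_nonneg (f 0)) L.coe_nonneg
  have hR : 0 ≤ R := by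
    have := hmono hT
    rw [gronwallBound_x0] at this
    exact (norm_nonneg p).trans this
  set g : (Fin d → ℝ) → (Fin d → ℝ) := fun y => f (clampBox R y) with hg
  have hgL : LipschitzWith L g := by
    simpa [Function.comp_def] using hf.comp (lipschitzWith_clampBox (d := d) R)
  have hgB : ∀ y, ‖g y‖ ≤ L * R + ‖f 0‖ := fun y =>
    (norm_le_of_lipschitzWith hf _).trans (by gcongr; exact norm_clampBox_le hR y)
  have hg0 : g 0 = f 0 := by rw [hg]; simp only; rw [clampBox_eq_self (by simpa using hR)]
  have hgG : ∀ y, ‖g y‖ ≤ L * ‖y‖ + ‖f 0‖ := fun y => hg0 ▸ norm_le_of_lipschitzWith hgL y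
  have hBnn : 0 ≤ L * R + ‖f 0‖ := by positivity
  have hPL : IsPicardLindelof (fun _ => g) (⟨0, by constructor <;> linarith⟩ : Icc (-T) T) p
      ⟨(L * R + ‖f 0‖) * T, by positivity⟩ 0 ⟨L * R + ‖f 0‖, hBnn⟩ L :=
    IsPicardLindelof.of_time_independent (fun y _ => hgB y) hgL.lipschitzOnWith
      (by
        change (L * R + ‖f 0‖) * max (T - 0) (0 - -T) ≤ (L * R + ‖f 0‖) * T - 0
        simp)
  obtain ⟨γ, h0, hγ⟩ := hPL.exists_eq_forall_mem_Icc_hasDerivWithinAt₀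
  simp only at h0
  have hcont : ContinuousOn γ (Icc (-T) T) := fun t ht => (hγ t ht).continuousWithinAt
  have hder : ∀ t ∈ Ioo (-T) T, HasDerivAt γ (g (γ t)) t := fun t ht =>
    (hγ t ⟨ht.1.le, ht.2.le⟩).hasDerivAt (Icc_mem_nhds ht.1 ht.2)
  have hfwd : ∀ t ∈ Ico 0 T, ‖γ t‖ ≤ R := by
    intro t ht
    refine (norm_le_gronwallBound_of_norm_deriv_right_le (f := γ) (f' := fun s => g (γ s))
      (δ := ‖p‖) (K := L) (ε := ‖f 0‖) (a := 0) (b := t)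
      (hcont.mono (Icc_subset_Icc (by linarith) ht.2.le))
      (fun s hs => (hder s ⟨by linarith [hs.1, hs.2, ht.2], hs.2.trans ht.2⟩).hasDerivWithinAt)
      (by rw [h0]) (fun s _ => hgG _) t ⟨ht.1, le_rfl⟩).trans ?_
    rw [sub_zero]; exact hmono ht.2.le
  have hbwd : ∀ t ∈ Ico 0 T, ‖γ (-t)‖ ≤ R := by
    intro t ht
    refine (norm_le_gronwallBound_of_norm_deriv_right_le (f := fun s => γ (-s))
      (f' := fun s => -g (γ (-s)))
      (δ := ‖p‖) (K := L) (ε := ‖f 0‖) (a := 0) (b := t)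
      (hcont.comp continuous_neg.continuousOn
        fun s hs => ⟨by linarith [hs.2, ht.2], by linarith [hs.1, hs.2, ht.2]⟩)
      (fun s hs => ?_)
      (by rw [neg_zero, h0]) (fun s _ => by rw [norm_neg]; exact hgG _) t ⟨ht.1, le_rfl⟩).trans ?_
    · have := HasDerivAt.scomp s (hder (-s)
        ⟨by linarith [hs.2, ht.2], by linarith [hs.1, hs.2, ht.2]⟩) (hasDerivAt_neg s)
      simpa [Function.comp_def] using this.hasDerivWithinAt
    · rw [sub_zero]; exact hmono ht.2.le
  refine ⟨γ, h0, fun t ht => ?_⟩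
  have hb : ‖γ t‖ ≤ R := by
    rcases le_total 0 t with h | h
    · exact hfwd t ⟨h, ht.2⟩
    · simpa using hbwd (-t) ⟨by linarith, by linarith [ht.1]⟩
  simpa [hg, clampBox_eq_self hb] using hder t ht

/-- Global existence for Lipschitz vector fields. -/
lemma exists_isIntegralCurve (hf : LipschitzWith L f) (p : Fin d → ℝ) :
    ∃ γ : ℝ → Fin d → ℝ, γ 0 = p ∧ IsIntegralCurve γ (fun _ => f) := by
  choose γ h0 hγ using fun n : ℕ => exists_solution_Ioo hf p (T := n + 1) (by positivity)
  have key : ∀ m n : ℕ, m ≤ n → EqOn (γ m) (γ n) (Ioo (-(m + 1 : ℝ)) (m + 1)) := by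
    intro m n hmn
    have hmn' : (m : ℝ) ≤ n := by exact_mod_cast hmn
    refine ODE_solution_unique_of_mem_Ioo (v := fun _ => f) (s := fun _ => univ) (K := L) (t₀ := 0)
      (fun _ _ => hf.lipschitzOnWith) ⟨by linarith [m.cast_nonneg (α := ℝ)],
        by linarith [m.cast_nonneg (α := ℝ)]⟩
      (fun t ht => ⟨hγ m t ht, mem_univ _⟩)
      (fun t ht => ⟨hγ n t ⟨by linarith [ht.1], by linarith [ht.2]⟩, mem_univ _⟩)
      (by rw [h0, h0])
  -- `γ n` solves the equation on `(-(n+1), n+1)`, so the index `⌈|t|⌉₊` suffices at `t`. Near `t`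
  -- the index is at most `⌈|t|⌉₊ + 1`, and all these local solutions agree with the one of that
  -- index.
  refine ⟨fun t => γ ⌈|t|⌉₊ t, by simp [h0], fun t => ?_⟩
  have hev : (fun s => γ ⌈|s|⌉₊ s) =ᶠ[𝓝 t] γ (⌈|t|⌉₊ + 1) := by
    have h1 : ∀ᶠ s in 𝓝 t, |s| < |t| + 1 :=
      continuous_abs.continuousAt.eventually_lt continuousAt_const (by linarith)
    filter_upwards [h1] with s hs
    refine key _ _ ?_ ?_
    · exact Nat.ceil_le.mpr (by push_cast; linarith [Nat.le_ceil |t|])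
    · have := Nat.le_ceil |s|
      have h2 := abs_le.mp (le_refl |s|)
      constructor <;> linarith
  have hd := hγ (⌈|t|⌉₊ + 1) t (by
    have := Nat.le_ceil |t|
    have h2 := abs_le.mp (le_refl |t|)
    push_cast
    constructor <;> linarith)
  have hd' := hd.congr_of_eventuallyEq hev
  have := hev.self_of_nhds
  simp only at this
  rwa [← this] at hd'

/-- The flow of a Lipschitz vector field. -/
def flow (f : (Fin d → ℝ) → (Fin d → ℝ)) (hf : ∃ L, LipschitzWith L f) (p : Fin d → ℝ) :
    ℝ → Fin d → ℝ :=
  (exists_isIntegralCurve hf.choose_spec p).choose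

variable (hf : ∃ L, LipschitzWith L f)

@[simp] lemma flow_zero (p : Fin d → ℝ) : flow f hf p 0 = p :=
  (exists_isIntegralCurve hf.choose_spec p).choose_spec.1

lemma isIntegralCurve_flow (p : Fin d → ℝ) : IsIntegralCurve (flow f hf p) (fun _ => f) :=
  (exists_isIntegralCurve hf.choose_spec p).choose_spec.2

lemma eq_flow {x : ℝ → Fin d → ℝ} (hx : IsIntegralCurve x (fun _ => f)) :
    x = flow f hf (x 0) :=
  isIntegralCurve_unique hf.choose_spec hx (isIntegralCurve_flow hf _) (by simp)

lemma flow_add (p : Fin d → ℝ) (s t : ℝ) :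
    flow f hf p (s + t) = flow f hf (flow f hf p s) t := by
  have h : IsIntegralCurve (fun t => flow f hf p (t + s)) (fun _ => f) := by
    intro t
    exact (isIntegralCurve_flow hf p (t + s)).comp_add_const t s
  have := congrFun (eq_flow hf h) t
  simpa [add_comm] using this

lemma norm_flow_sub_flow_le (hL : LipschitzWith L f) (p q : Fin d → ℝ) (t : ℝ) :
    ‖flow f hf p t - flow f hf q t‖ ≤ ‖p - q‖ * Real.exp (L * |t|) := by
  simpa using norm_sub_le_of_isIntegralCurve hL (isIntegralCurve_flow hf p)
    (isIntegralCurve_flow hf q) t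

lemma continuous_flow_left (t : ℝ) : Continuous fun p => flow f hf p t := by
  obtain ⟨L, hL⟩ := id hf
  refine (LipschitzWith.of_dist_le_mul (K := ⟨Real.exp (L * |t|), by positivity⟩)
    fun p q => ?_).continuous
  rw [dist_eq_norm, dist_eq_norm, mul_comm]
  exact norm_flow_sub_flow_le hf hL p q t

lemma continuous_flow_right (p : Fin d → ℝ) : Continuous (flow f hf p) :=
  (isIntegralCurve_flow hf p).continuous

/-- Orbits of a bounded set are bounded over bounded time intervals. -/
lemma exists_norm_flow_le (B T : ℝ) :
    ∃ C, 0 ≤ C ∧ ∀ p : Fin d → ℝ, ‖p‖ ≤ B → ∀ t, |t| ≤ T → ‖flow f hf p t‖ ≤ C := by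
  obtain ⟨L, hL⟩ := id hf
  obtain ⟨C, hC⟩ := (isCompact_Icc (a := -T) (b := T)).exists_bound_of_continuousOn
    (continuous_flow_right hf 0).continuousOn
  refine ⟨|C| + |B| * Real.exp (L * |T|), by positivity, fun p hp t ht => ?_⟩
  have h1 := norm_flow_sub_flow_le hf hL p 0 t
  rw [sub_zero] at h1
  have h2 := hC t (abs_le.mp ht)
  have h3 := norm_le_norm_sub_add (flow f hf p t) (flow f hf 0 t)
  have h4 : ‖p‖ * Real.exp (L * |t|) ≤ |B| * Real.exp (L * |T|) := by
    have h5 := ht.trans (le_abs_self T)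
    have h6 := hp.trans (le_abs_self B)
    exact mul_le_mul h6 (Real.exp_le_exp.mpr (mul_le_mul_of_nonneg_left h5 L.coe_nonneg))
      (by positivity) (by positivity)
  linarith [le_abs_self C]

lemma norm_flow_sub_flow_time_le {p : Fin d → ℝ} {C : ℝ} {a b s t : ℝ}
    (hC : ∀ u ∈ Icc a b, ‖f (flow f hf p u)‖ ≤ C) (hs : s ∈ Icc a b) (ht : t ∈ Icc a b) :
    ‖flow f hf p t - flow f hf p s‖ ≤ C * |t - s| :=
  (convex_Icc a b).norm_image_sub_le_of_norm_hasDerivWithin_le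
    (fun u _ => (isIntegralCurve_flow hf p u).hasDerivWithinAt) hC hs ht

lemma flow_smul_eq {c : ℝ} (hc : ∃ L, LipschitzWith L fun y => c • f y) (p : Fin d → ℝ) (t : ℝ) :
    flow (fun y => c • f y) hc p t = flow f hf p (t * c) := by
  have h : IsIntegralCurve (fun t => flow f hf p (t * c)) (fun _ y => c • f y) := by
    have := (isIntegralCurve_flow hf p).comp_mul c
    exact this
  have := congrFun (eq_flow hc h) t
  simpa using this.symm

end Flow

/-- A globally asymptotically stable origin attracts the unit ball uniformly. -/
lemma IsGASOrigin.exists_uniform_time {d : ℕ} {f : (Fin d → ℝ) → (Fin d → ℝ)}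
    (h : IsGASOrigin f) (hf : ∃ L, LipschitzWith L f) {ε : ℝ} (hε : 0 < ε) :
    ∃ T > 0, ∀ p : Fin d → ℝ, ‖p‖ ≤ 1 → ∀ t ≥ T, ‖flow f hf p t‖ < ε := by
  obtain ⟨δ, hδ, hst⟩ := h.stable ε hε
  have hon : ∀ p, IsIntegralCurveOn (flow f hf p) (fun _ => f) (Ici 0) := fun p =>
    (isIntegralCurve_flow hf p).isIntegralCurveOn _
  have hT : ∀ p : Fin d → ℝ, ∃ T : ℝ, ‖flow f hf p T‖ < δ := by
    intro p
    have := (h.attractive _ (hon p)).norm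
    rw [norm_zero] at this
    exact (this.eventually_lt_const hδ).exists
  choose τ hτ using hT
  -- Each point `p` enters the `δ`-ball at some time `τ p`, and so do its neighbours at the same
  -- time. Compactness leaves finitely many such times, after the largest of which Lyapunov
  -- stability keeps all orbits below `ε`.
  obtain ⟨s, hs⟩ := (isCompact_closedBall (0 : Fin d → ℝ) 1).elim_finite_subcover
    (fun p => {q | ‖flow f hf q (τ p)‖ < δ})
    (fun p => isOpen_lt (continuous_flow_left hf _).norm continuous_const)
    (fun p _ => mem_iUnion.mpr ⟨p, hτ p⟩)
  obtain ⟨T, hT⟩ := (s.image τ).bddAbove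
  refine ⟨max T 1, by positivity, fun p hp t ht => ?_⟩
  obtain ⟨q, hq, hpq⟩ := mem_iUnion₂.mp (hs (mem_closedBall_zero_iff.mpr hp))
  have hτt : τ q ≤ t := (hT (by simpa using ⟨q, hq, rfl⟩)).trans ((le_max_left _ _).trans ht)
  have := hst _ (hon (flow f hf p (τ q))) (by simpa using hpq) (t - τ q) (by linarith)
  rw [← flow_add] at this
  simpa using this

end AsyncSA
end

noncomputable section

namespace AsyncSA

/-! ### Component clocks -/

section Clocks

/-- The stepsize with which component `i` is updated at iteration `k` (`0` if it is not updated). -/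
def compStep {d : ℕ} (α : ℕ → ℝ) (Y : ℕ → Finset (Fin d)) (k : ℕ) (i : Fin d) : ℝ :=
  if i ∈ Y k then α (updateCount Y k i) else 0

/-- The partial sums of the stepsizes. -/
def stepSum (α : ℕ → ℝ) (n : ℕ) : ℝ := ∑ k ∈ Finset.range n, α k

/-- The elapsed time of component `i` before iteration `n`. -/
def compTime {d : ℕ} (α : ℕ → ℝ) (Y : ℕ → Finset (Fin d)) (n : ℕ) (i : Fin d) : ℝ :=
  ∑ k ∈ Finset.range n, compStep α Y k i

variable {d : ℕ} {α : ℕ → ℝ} {Y : ℕ → Finset (Fin d)}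

lemma updateCount_succ (n : ℕ) (i : Fin d) :
    updateCount Y (n + 1) i = updateCount Y n i + if i ∈ Y n then 1 else 0 := by
  unfold updateCount
  rw [Finset.range_add_one, Finset.filter_insert]
  split_ifs with h
  · rw [Finset.card_insert_of_notMem (by simp)]
  · simp

lemma updateCount_le (n : ℕ) (i : Fin d) : updateCount Y n i ≤ n :=
  (Finset.card_filter_le _ _).trans (by simp)

lemma updateCount_mono (i : Fin d) : Monotone fun n => updateCount Y n i :=
  monotone_nat_of_le_succ fun n => by rw [updateCount_succ]; omega

/-- The counter of component `i` takes each of the values `0, 1, 2, …` at exactly one update, so a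
sum over updates is an initial partial sum of `g`. -/
lemma sum_comp_updateCount (g : ℕ → ℝ) (n : ℕ) (i : Fin d) :
    ∑ k ∈ Finset.range n, (if i ∈ Y k then g (updateCount Y k i) else 0) =
      ∑ k ∈ Finset.range (updateCount Y n i), g k := by
  induction n with
  | zero => simp [updateCount]
  | succ n ih =>
    rw [Finset.sum_range_succ, ih, updateCount_succ]
    split_ifs
    · rw [Finset.sum_range_succ]
    · simp

lemma compTime_eq (n : ℕ) (i : Fin d) : compTime α Y n i = stepSum α (updateCount Y n i) :=
  sum_comp_updateCount α n i

lemma compTime_succ (n : ℕ) (i : Fin d) :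
    compTime α Y (n + 1) i = compTime α Y n i + compStep α Y n i :=
  Finset.sum_range_succ _ _

lemma stepSum_succ (n : ℕ) : stepSum α (n + 1) = stepSum α n + α n :=
  Finset.sum_range_succ _ _

lemma aggTime_succ (n : ℕ) : aggTime α Y (n + 1) = aggTime α Y n + aggStep α Y n :=
  Finset.sum_range_succ _ _

lemma aggStep_eq (n : ℕ) : aggStep α Y n = ∑ i, compStep α Y n i := by
  simp [aggStep, compStep]

lemma aggTime_eq (n : ℕ) : aggTime α Y n = ∑ i, compTime α Y n i := by
  simp only [aggTime, compTime, aggStep_eq]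
  exact Finset.sum_comm

lemma sum_Icc_eq_stepSum_sub {m n : ℕ} (h : m ≤ n) :
    ∑ k ∈ Finset.Icc m n, α k = stepSum α (n + 1) - stepSum α m := by
  rw [← Finset.Ico_add_one_right_eq_Icc, Finset.sum_Ico_eq_sub _ (by omega)]
  rfl

lemma compStep_nonneg (hα : ∀ n, 0 < α n) (k : ℕ) (i : Fin d) : 0 ≤ compStep α Y k i := by
  unfold compStep
  split_ifs
  exacts [(hα _).le, le_rfl]

lemma compStep_le_aggStep (hα : ∀ n, 0 < α n) (k : ℕ) (i : Fin d) :
    compStep α Y k i ≤ aggStep α Y k := by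
  rw [aggStep_eq]
  exact Finset.single_le_sum (f := fun i => compStep α Y k i)
    (fun j _ => compStep_nonneg hα k j) (Finset.mem_univ i)

lemma aggStep_pos (hα : ∀ n, 0 < α n) (hY : ∀ n, (Y n).Nonempty) (n : ℕ) : 0 < aggStep α Y n :=
  Finset.sum_pos (fun _ _ => hα _) (hY n)

lemma aggTime_strictMono (hα : ∀ n, 0 < α n) (hY : ∀ n, (Y n).Nonempty) :
    StrictMono (aggTime α Y) :=
  strictMono_nat_of_lt_succ fun n => by rw [aggTime_succ]; linarith [aggStep_pos hα hY n]

lemma stepSum_strictMono (hα : ∀ n, 0 < α n) : StrictMono (stepSum α) :=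
  strictMono_nat_of_lt_succ fun n => by rw [stepSum_succ]; linarith [hα n]

lemma compTime_mono (hα : ∀ n, 0 < α n) (i : Fin d) : Monotone fun n => compTime α Y n i :=
  monotone_nat_of_le_succ fun n => by rw [compTime_succ]; linarith [compStep_nonneg (Y := Y) hα n i]

/-- The bound is free of `Y`, hence uniform over sample paths, as the L² estimate of the noise
requires. -/
lemma sum_compStep_sq_le (h : Summable fun n => α n ^ 2) (n : ℕ) (i : Fin d) :
    ∑ k ∈ Finset.range n, compStep α Y k i ^ 2 ≤ ∑' k, α k ^ 2 := by
  have : ∀ k, compStep α Y k i ^ 2 = if i ∈ Y k then (α (updateCount Y k i)) ^ 2 else 0 := by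
    intro k
    unfold compStep
    split_ifs <;> simp
  simp only [this]
  rw [sum_comp_updateCount (fun k => α k ^ 2)]
  exact h.sum_le_tsum _ fun _ _ => sq_nonneg _

/-! ### Stepsizes and the windows they define -/

namespace StepsizeConditions

lemma tendsto_zero (h : StepsizeConditions α) : Tendsto α atTop (𝓝 0) := by
  have := h.summable_sq.tendsto_atTop_zero
  have h2 := (Real.continuous_sqrt.tendsto 0).comp this
  rw [Real.sqrt_zero] at h2
  refine h2.congr fun n => ?_
  simp [Real.sqrt_sq (h.pos n).le]

lemma tendsto_stepSum (h : StepsizeConditions α) : Tendsto (stepSum α) atTop atTop :=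
  (not_summable_iff_tendsto_nat_atTop_of_nonneg fun n => (h.pos n).le).mp h.not_summable

lemma tendsto_compStep (h : StepsizeConditions α) (i : Fin d) :
    Tendsto (fun k => compStep α Y k i) atTop (𝓝 0) := by
  have hs : Summable fun k => compStep α Y k i ^ 2 :=
    summable_of_sum_range_le (fun _ => sq_nonneg _) fun n => sum_compStep_sq_le h.summable_sq n i
  have h2 := (Real.continuous_sqrt.tendsto 0).comp hs.tendsto_atTop_zero
  rw [Real.sqrt_zero] at h2
  refine h2.congr fun n => ?_
  simp [Real.sqrt_sq (compStep_nonneg h.pos n i)]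

lemma tendsto_aggStep (h : StepsizeConditions α) : Tendsto (aggStep α Y) atTop (𝓝 0) := by
  have := tendsto_finsetSum (Finset.univ : Finset (Fin d))
    fun i _ => h.tendsto_compStep (Y := Y) i
  simpa [← aggStep_eq] using this

lemma exists_antitoneFrom (h : StepsizeConditions α) :
    ∃ n₀, ∀ m n, n₀ ≤ m → m ≤ n → α n ≤ α m := by
  obtain ⟨n₀, hn₀⟩ := eventually_atTop.mp h.eventually_nonincreasing
  refine ⟨n₀, fun m n hm hmn => ?_⟩
  induction n, hmn using Nat.le_induction with
  | base => exact le_rfl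
  | succ n hmn ih => exact (hn₀ n (hm.trans hmn)).trans ih

variable {x : ℝ}

lemma windowEnd_spec (h : StepsizeConditions α) (x : ℝ) (n : ℕ) :
    n < windowEnd α n x ∧ x ≤ stepSum α (windowEnd α n x + 1) - stepSum α n := by
  have hne : {m : ℕ | n < m ∧ x ≤ ∑ k ∈ Finset.Icc n m, α k}.Nonempty := by
    obtain ⟨m, hm, hm'⟩ := ((h.tendsto_stepSum.eventually_ge_atTop (x + stepSum α n)).and
      (eventually_gt_atTop n)).exists
    refine ⟨m, hm', ?_⟩
    rw [sum_Icc_eq_stepSum_sub hm'.le, stepSum_succ]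
    linarith [h.pos m]
  have : windowEnd α n x ∈ {m : ℕ | n < m ∧ x ≤ ∑ k ∈ Finset.Icc n m, α k} := Nat.sInf_mem hne
  refine ⟨this.1, ?_⟩
  rw [← sum_Icc_eq_stepSum_sub this.1.le]
  exact this.2

lemma eventually_stepSum_windowEnd_lt (h : StepsizeConditions α) (hx : 0 < x) :
    ∀ᶠ n in atTop, stepSum α (windowEnd α n x) - stepSum α n < x := by
  filter_upwards [h.tendsto_zero.eventually_lt_const hx] with n hn
  have hN := (h.windowEnd_spec x n).1
  by_contra! hcon
  rcases Nat.lt_or_ge (n + 1) (windowEnd α n x) with h1 | h1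
  · have hmem : windowEnd α n x - 1 ∈ {m : ℕ | n < m ∧ x ≤ ∑ k ∈ Finset.Icc n m, α k} := by
      refine ⟨by omega, ?_⟩
      rw [sum_Icc_eq_stepSum_sub (by omega), Nat.sub_add_cancel (by omega)]
      exact hcon
    have := Nat.sInf_le hmem
    change windowEnd α n x ≤ _ at this
    omega
  -- Minimality gives nothing here, since the definition of `windowEnd` excludes `m = n`; but the
  -- window is then the single step `α n`, which is below `x`.
  · have : windowEnd α n x = n + 1 := by omega
    rw [this, stepSum_succ] at hcon
    linarith

lemma tendsto_windowEnd (h : StepsizeConditions α) (x : ℝ) :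
    Tendsto (fun n => windowEnd α n x) atTop atTop :=
  tendsto_atTop_mono (fun n => (h.windowEnd_spec x n).1.le) tendsto_id

lemma tendsto_stepSum_windowEnd (h : StepsizeConditions α) (hx : 0 < x) :
    Tendsto (fun n => stepSum α (windowEnd α n x) - stepSum α n) atTop (𝓝 x) := by
  have h1 : Tendsto (fun n => x - α (windowEnd α n x)) atTop (𝓝 x) := by
    simpa using (tendsto_const_nhds (x := x)).sub (h.tendsto_zero.comp (h.tendsto_windowEnd x))
  refine tendsto_of_tendsto_of_tendsto_of_le_of_le' h1 tendsto_const_nhds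
    (Eventually.of_forall fun n => ?_)
    ((h.eventually_stepSum_windowEnd_lt hx).mono fun n hn => hn.le)
  have := (h.windowEnd_spec x n).2
  rw [stepSum_succ] at this
  linarith

end StepsizeConditions

/-- If the increments of two sequences over consecutive windows are asymptotically proportional and
both sequences grow like a common clock, the proportionality factor is `1`. -/
lemma eq_one_of_window_proportional {Q Q' S : ℕ → ℝ} {N : ℕ → ℕ} {x l : ℝ}
    (hN : ∀ n, n < N n) (hx : 0 < x)
    (hQ : Tendsto (fun n => Q n / S n) atTop (𝓝 1))
    (hQ' : Tendsto (fun n => Q' n / S n) atTop (𝓝 1))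
    (hS : Tendsto (fun n => S (N n) - S n) atTop (𝓝 x)) (hS' : Tendsto S atTop atTop)
    (hl : Tendsto (fun n => (Q (N n) - Q n) - l * (Q' (N n) - Q' n)) atTop (𝓝 0)) : l = 1 := by
  -- The points `u k` cut the indices into consecutive windows. Increments telescope along `u`, so
  -- Cesàro averaging turns limits of window increments into growth rates per window.
  set u : ℕ → ℕ := fun k => N^[k] 0 with hu
  have husucc : ∀ k, u (k + 1) = N (u k) := fun k => Function.iterate_succ_apply' N k 0
  have hut : Tendsto u atTop atTop :=
    (strictMono_nat_of_lt_succ fun k => by rw [husucc]; exact hN _).tendsto_atTop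
  have ces : ∀ {G : ℕ → ℝ} {c : ℝ}, Tendsto (fun n => G (N n) - G n) atTop (𝓝 c) →
      Tendsto (fun k : ℕ => G (u k) / k) atTop (𝓝 c) := by
    intro G c hG
    have h1 := (hG.comp hut).cesaro
    have h2 : Tendsto (fun k : ℕ => (k : ℝ)⁻¹ * G (u 0)) atTop (𝓝 0) := by
      simpa using (tendsto_inv_atTop_nhds_zero_nat (𝕜 := ℝ)).mul_const (G (u 0))
    have h3 := h1.add h2
    rw [add_zero] at h3
    refine h3.congr fun k => ?_
    have : ∀ i, ((fun n => G (N n) - G n) ∘ u) i = G (u (i + 1)) - G (u i) := by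
      intro i; simp [husucc]
    simp only [this]
    rw [Finset.sum_range_sub (fun i => G (u i))]
    ring
  have hSk := ces hS
  have hne : ∀ᶠ k in atTop, S (u k) ≠ 0 :=
    (hut.eventually (hS'.eventually_gt_atTop 0)).mono fun k hk => hk.ne'
  have grow : ∀ {Q : ℕ → ℝ}, Tendsto (fun n => Q n / S n) atTop (𝓝 1) →
      Tendsto (fun k : ℕ => Q (u k) / k) atTop (𝓝 x) := by
    intro Q hQ
    have := (hQ.comp hut).mul hSk
    rw [one_mul] at this
    refine this.congr' ?_
    filter_upwards [hne] with k hk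
    simp only [Function.comp]
    field_simp
  -- The growth rate of `Q - l Q'` per window is `0` by `hl`, and `x - l x` because `Q` and `Q'`
  -- both grow like `S`.
  have h1 := ces (G := fun n => Q n - l * Q' n) (c := 0) (hl.congr fun n => by ring)
  have h2 := (grow hQ).sub ((grow hQ').const_mul l)
  have h3 : x - l * x = 0 := tendsto_nhds_unique h2 (h1.congr fun k => by ring)
  have : x * (1 - l) = 0 := by linarith
  rcases mul_eq_zero.mp this with h | h
  · exact absurd h hx.ne'
  · linarith

/-- A sequence that is Lipschitz with respect to a clock `S` and asymptotically constant over windows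
of length about `x` varies little over bounded stretches of the clock. -/
lemma eventually_abs_sub_le_of_window {g S : ℕ → ℝ} {N : ℕ → ℕ} {x C : ℝ} (hx : 0 < x)
    (hC : 0 ≤ C) (hN : ∀ n, n < N n) (hmono : Monotone S)
    (hS : Tendsto (fun n => S (N n) - S n) atTop (𝓝 x))
    (hg : Tendsto (fun n => g (N n) - g n) atTop (𝓝 0))
    (hlip : ∀ᶠ m in atTop, ∀ k ≥ m, |g k - g m| ≤ C * (S k - S m)) (T : ℝ) {η : ℝ} (hη : 0 < η) :
    ∀ᶠ m in atTop, ∀ k ≥ m, S k - S m ≤ T → |g k - g m| ≤ η + C * (2 * x) := by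
  -- Late windows have length between `x / 2` and `2 * x`, so `q` of them cover a stretch of length
  -- `T`. Each complete window costs `η / (q + 1)`; the incomplete one at the end costs at most `C *
  -- (2 * x)` by the Lipschitz bound.
  obtain ⟨q, hq⟩ := exists_nat_ge (T / (x / 2))
  have hq' : T ≤ q * (x / 2) := (div_le_iff₀ (by positivity)).mp hq
  have hη' : 0 < η / (q + 1) := by positivity
  obtain ⟨m₀, hm₀⟩ := eventually_atTop.mp
    ((hS.eventually (Icc_mem_nhds (show x / 2 < x by linarith) (show x < 2 * x by linarith))).and
      ((hg.eventually (Icc_mem_nhds (neg_lt_zero.mpr hη') hη')).and hlip))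
  have key : ∀ r : ℕ, ∀ m ≥ m₀, ∀ k ≥ m, S k - S m ≤ r * (x / 2) →
      |g k - g m| ≤ r * (η / (q + 1)) + C * (2 * x) := by
    intro r
    induction r with
    | zero =>
      intro m hm k hk h
      have h1 := (hm₀ m hm).2.2 k hk
      have h2 : C * (S k - S m) ≤ C * (2 * x) := by
        gcongr
        push_cast at h
        linarith
      push_cast
      linarith
    | succ r ih =>
      intro m hm k hk h
      obtain ⟨hS1, hg1, hl1⟩ := hm₀ m hm
      rcases lt_or_ge k (N m) with hkN | hkN
      · have h1 := hl1 k hk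
        have h2 : C * (S k - S m) ≤ C * (2 * x) := by
          gcongr
          linarith [hmono hkN.le, hS1.2]
        have h3 : 0 ≤ ((r + 1 : ℕ) : ℝ) * (η / (q + 1)) := by positivity
        linarith
      · have h1 := ih (N m) (hm.trans (hN m).le) k hkN (by
          push_cast at h
          linarith [hS1.1])
        have h2 := abs_sub_le (g k) (g (N m)) (g m)
        have h3 : |g (N m) - g m| ≤ η / (q + 1) := abs_le.mpr hg1
        push_cast
        linarith
  filter_upwards [eventually_ge_atTop m₀] with m hm k hk h
  refine (key q m hm k hk (h.trans hq')).trans ?_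
  gcongr
  rw [mul_div_assoc', div_le_iff₀ (by positivity)]
  nlinarith

/-- The conditions on the sequence of updates along one sample path. -/
structure RegularUpdates (α : ℕ → ℝ) (Y : ℕ → Finset (Fin d)) : Prop where
  nonempty : ∀ n, (Y n).Nonempty
  frequency : ∃ Δ > (0 : ℝ), ∀ i : Fin d,
    Δ ≤ liminf (fun n : ℕ => (updateCount Y n i : ℝ) / n) atTop
  balance : ∀ p : ℕ, ∀ i j : Fin d, ∃ l : ℝ,
    Tendsto
      (fun n : ℕ =>
        (∑ k ∈ Finset.Icc (updateCount Y n i)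
            (updateCount Y (windowEnd α n (1 / ((p : ℝ) + 1))) i), α k) /
        ∑ k ∈ Finset.Icc (updateCount Y n j)
            (updateCount Y (windowEnd α n (1 / ((p : ℝ) + 1))) j), α k)
      atTop (𝓝 l)

/-! ### Component clocks along a regular sample path -/

namespace RegularUpdates

variable (hY : RegularUpdates α Y) (hα : StepsizeConditions α)

include hY in
lemma exists_mul_le_updateCount :
    ∃ x ∈ Ioo (0 : ℝ) 1, ∀ i, ∀ᶠ n : ℕ in atTop, x * n ≤ updateCount Y n i := by
  obtain ⟨Δ, hΔ, hfreq⟩ := hY.frequency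
  refine ⟨min (Δ / 2) (1 / 2), ⟨by positivity, by
    linarith [min_le_right (Δ / 2) (1 / 2 : ℝ)]⟩, fun i => ?_⟩
  have hlt : Δ / 2 < liminf (fun n : ℕ => (updateCount Y n i : ℝ) / n) atTop :=
    lt_of_lt_of_le (by linarith) (hfreq i)
  have hb : IsBoundedUnder (· ≥ ·) atTop (fun n : ℕ => (updateCount Y n i : ℝ) / n) :=
    isBoundedUnder_of ⟨0, fun n => by positivity⟩
  filter_upwards [eventually_lt_of_lt_liminf hlt hb, eventually_gt_atTop 0] with n hn hn0
  have hn0' : (0 : ℝ) < n := by exact_mod_cast hn0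
  rw [lt_div_iff₀ hn0'] at hn
  refine le_trans ?_ hn.le
  gcongr
  exact min_le_left _ _

include hY in
lemma tendsto_updateCount (i : Fin d) : Tendsto (fun n => updateCount Y n i) atTop atTop := by
  obtain ⟨x, hx, h⟩ := hY.exists_mul_le_updateCount
  have h1 : Tendsto (fun n : ℕ => x * (n : ℝ)) atTop atTop :=
    tendsto_natCast_atTop_atTop.const_mul_atTop hx.1
  exact tendsto_natCast_atTop_iff.mp (tendsto_atTop_mono' _ (h i) h1)

include hY hα in
-- Eventually `ν(n, i) ≥ x n`, so monotonicity gives `α_{ν(n,i)} ≤ α_{⌊xn⌋}`, and the ratio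
-- condition compares the latter with `α_n`.
lemma exists_compStep_le :
    ∃ C, 0 ≤ C ∧ ∀ i, ∀ᶠ n in atTop, compStep α Y n i ≤ C * α n := by
  obtain ⟨x, hx, h⟩ := hY.exists_mul_le_updateCount
  obtain ⟨n₀, hn₀⟩ := hα.exists_antitoneFrom
  obtain ⟨C, hC⟩ := hα.ratio_bdd x hx
  have hC0 : 0 ≤ C := (div_pos (hα.pos _) (hα.pos 0)).le.trans (hC ⟨0, rfl⟩)
  refine ⟨C, hC0, fun i => ?_⟩
  have hfl : Tendsto (fun n : ℕ => ⌊x * (n : ℝ)⌋₊) atTop atTop :=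
    tendsto_nat_floor_atTop.comp (tendsto_natCast_atTop_atTop.const_mul_atTop hx.1)
  filter_upwards [h i, hfl.eventually_ge_atTop n₀] with n h1 h2
  have h3 : α ⌊x * (n : ℝ)⌋₊ ≤ C * α n := (div_le_iff₀ (hα.pos n)).mp (hC ⟨n, rfl⟩)
  unfold compStep
  split_ifs
  · exact (hn₀ _ _ h2 (Nat.floor_le_of_le h1)).trans h3
  · exact mul_nonneg hC0 (hα.pos n).le

include hY hα in
-- Some component is updated, and its counter is at most `n` and, late enough, in the range where
-- the stepsizes decrease.
lemma eventually_le_aggStep : ∀ᶠ n in atTop, α n ≤ aggStep α Y n := by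
  obtain ⟨n₀, hn₀⟩ := hα.exists_antitoneFrom
  have : ∀ᶠ n in atTop, ∀ i, n₀ ≤ updateCount Y n i :=
    eventually_all.mpr fun i => (hY.tendsto_updateCount i).eventually_ge_atTop n₀
  filter_upwards [this] with n hn
  obtain ⟨i, hi⟩ := hY.nonempty n
  refine le_trans ?_ (compStep_le_aggStep hα.pos n i)
  rw [compStep, if_pos hi]
  exact hn₀ _ _ (hn i) (updateCount_le n i)

include hY hα in
/-- Eventually, the aggregated clock runs at least as fast as the stepsize clock. -/
lemma eventually_stepSum_sub_le :
    ∀ᶠ m in atTop, ∀ k ≥ m, stepSum α k - stepSum α m ≤ aggTime α Y k - aggTime α Y m := by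
  obtain ⟨n₀, hn₀⟩ := eventually_atTop.mp (hY.eventually_le_aggStep hα)
  filter_upwards [eventually_ge_atTop n₀] with m hm k hk
  induction k, hk using Nat.le_induction with
  | base => simp
  | succ k hk ih =>
    rw [stepSum_succ, aggTime_succ]
    linarith [hn₀ k (hm.trans hk)]

include hY hα in
lemma tendsto_aggTime : Tendsto (aggTime α Y) atTop atTop := by
  obtain ⟨m, hm⟩ := (hY.eventually_stepSum_sub_le hα).exists
  have h1 : Tendsto (fun k => stepSum α k + (aggTime α Y m - stepSum α m)) atTop atTop :=
    tendsto_atTop_add_const_right _ _ hα.tendsto_stepSum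
  refine tendsto_atTop_mono' _ ?_ h1
  filter_upwards [eventually_ge_atTop m] with k hk
  linarith [hm k hk]

include hY hα in
lemma exists_compTime_sub_le : ∃ C, 0 ≤ C ∧ ∀ i, ∀ᶠ m in atTop, ∀ k ≥ m,
    compTime α Y k i - compTime α Y m i ≤ C * (stepSum α k - stepSum α m) := by
  obtain ⟨C, hC, h⟩ := hY.exists_compStep_le hα
  refine ⟨C, hC, fun i => ?_⟩
  obtain ⟨n₀, hn₀⟩ := eventually_atTop.mp (h i)
  filter_upwards [eventually_ge_atTop n₀] with m hm k hk
  induction k, hk using Nat.le_induction with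
  | base => simp
  | succ k hk ih =>
    rw [stepSum_succ, compTime_succ]
    linarith [hn₀ k (hm.trans hk)]

include hY hα in
-- The partial-sum condition is applied with `y = ν(n, i) / n`, which varies with `n` but stays in
-- `[x, 1]`; this is where uniformity in `y` is needed.
lemma tendsto_compTime_div_stepSum (i : Fin d) :
    Tendsto (fun n => compTime α Y n i / stepSum α n) atTop (𝓝 1) := by
  obtain ⟨x, hx, h⟩ := hY.exists_mul_le_updateCount
  have h1 : Tendsto (fun n => stepSum α (updateCount Y n i + 1) / stepSum α (n + 1)) atTop
      (𝓝 1) := by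
    rw [Metric.tendsto_nhds]
    intro ε hε
    have := Metric.tendstoUniformlyOn_iff.mp (hα.partial_sums x hx) ε hε
    filter_upwards [this, h i, eventually_gt_atTop 0] with n hn hxn hn0
    have hn0' : (0 : ℝ) < n := by exact_mod_cast hn0
    have hν : (updateCount Y n i : ℝ) / n * n = updateCount Y n i := by field_simp
    have h2 := hn ((updateCount Y n i : ℝ) / n) ⟨(le_div_iff₀ hn0').mpr hxn,
      (div_le_one hn0').mpr (by exact_mod_cast updateCount_le n i)⟩
    rw [hν, Nat.floor_natCast, dist_comm] at h2
    exact h2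
  have hpos : ∀ᶠ n in atTop, 0 < stepSum α n := hα.tendsto_stepSum.eventually_gt_atTop 0
  have hinv : Tendsto (fun n => (stepSum α n)⁻¹) atTop (𝓝 0) :=
    tendsto_inv_atTop_zero.comp hα.tendsto_stepSum
  -- The condition on partial sums includes the last index and the clocks do not; `h2` and `h3`
  -- correct for the two extra terms.
  have h2 : Tendsto (fun n => 1 + α n * (stepSum α n)⁻¹) atTop (𝓝 1) := by
    simpa using (tendsto_const_nhds (x := (1 : ℝ))).add (hα.tendsto_zero.mul hinv)
  have h3 : Tendsto (fun n => α (updateCount Y n i) * (stepSum α n)⁻¹) atTop (𝓝 0) := by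
    simpa using (hα.tendsto_zero.comp (hY.tendsto_updateCount i)).mul hinv
  have h4 := (h1.mul h2).sub h3
  rw [mul_one, sub_zero] at h4
  refine h4.congr' ?_
  filter_upwards [hpos] with n hn
  have hn' : 0 < stepSum α n + α n := by linarith [hα.pos n]
  rw [compTime_eq, stepSum_succ, stepSum_succ]
  field_simp
  ring

include hY hα in
-- The window sums are bounded, so convergence of their ratio to `l` becomes `P i - l * P j → 0`,
-- and `l = 1` because both clocks are asymptotic to `stepSum`.
lemma tendsto_compTime_window (p : ℕ) (i j : Fin d) :
    Tendsto (fun n =>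
      (compTime α Y (windowEnd α n (1 / ((p : ℝ) + 1))) i -
        compTime α Y (windowEnd α n (1 / ((p : ℝ) + 1))) j) -
      (compTime α Y n i - compTime α Y n j)) atTop (𝓝 0) := by
  set x : ℝ := 1 / ((p : ℝ) + 1) with hxdef
  have hx : 0 < x := by positivity
  obtain ⟨l, hl⟩ := hY.balance p i j
  set N : ℕ → ℕ := fun n => windowEnd α n x with hNdef
  have hN : ∀ n, n < N n := fun n => (hα.windowEnd_spec x n).1
  have hNt : Tendsto N atTop atTop := hα.tendsto_windowEnd x
  set P : Fin d → ℕ → ℝ := fun i n =>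
    ∑ k ∈ Finset.Icc (updateCount Y n i) (updateCount Y (N n) i), α k with hP
  -- The sums in the balance condition include their right endpoint, and so exceed the clock
  -- increment by one vanishing stepsize.
  have hPeq : ∀ i n, P i n = compTime α Y (N n) i - compTime α Y n i +
      α (updateCount Y (N n) i) := by
    intro i n
    simp only [hP]
    rw [sum_Icc_eq_stepSum_sub (updateCount_mono i (hN n).le), stepSum_succ, compTime_eq,
      compTime_eq]
    ring
  have hα0 : ∀ i, Tendsto (fun n => α (updateCount Y (N n) i)) atTop (𝓝 0) := fun i =>
    hα.tendsto_zero.comp ((hY.tendsto_updateCount i).comp hNt)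
  have hPpos : ∀ i n, 0 < P i n := fun i n => Finset.sum_pos (fun _ _ => hα.pos _)
    (Finset.nonempty_Icc.mpr (updateCount_mono i (hN n).le))
  obtain ⟨C, hC, hCb⟩ := hY.exists_compTime_sub_le hα
  have hPb : ∀ᶠ n in atTop, ‖P j n‖ ≤ C * x + 1 := by
    filter_upwards [hCb j, hα.eventually_stepSum_windowEnd_lt hx,
      (hα0 j).eventually_lt_const one_pos] with n h1 h2 h3
    rw [Real.norm_of_nonneg (hPpos j n).le, hPeq]
    have := h1 (N n) (hN n).le
    have h4 : C * (stepSum α (N n) - stepSum α n) ≤ C * x := by gcongr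
    linarith
  have hdiff : Tendsto (fun n => P i n - l * P j n) atTop (𝓝 0) := by
    have h0 : Tendsto (fun n => P i n / P j n - l) atTop (𝓝 0) := by
      rw [← sub_self l]
      exact hl.sub_const l
    have h1 := h0.zero_mul_isBoundedUnder_le (g := P j)
      (isBoundedUnder_of_eventually_le (a := C * x + 1) hPb)
    refine h1.congr fun n => ?_
    have := (hPpos j n).ne'
    field_simp
  have hdiff' : Tendsto (fun n => (compTime α Y (N n) i - compTime α Y n i) -
      l * (compTime α Y (N n) j - compTime α Y n j)) atTop (𝓝 0) := by
    have h1 := (hdiff.sub (hα0 i)).add ((hα0 j).const_mul l)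
    simp only [sub_zero, mul_zero, add_zero] at h1
    refine h1.congr fun n => ?_
    rw [hPeq, hPeq]
    ring
  have hl1 : l = 1 := eq_one_of_window_proportional hN hx
    (hY.tendsto_compTime_div_stepSum hα i) (hY.tendsto_compTime_div_stepSum hα j)
    (hα.tendsto_stepSum_windowEnd hx) hα.tendsto_stepSum hdiff'
  rw [hl1] at hdiff'
  exact hdiff'.congr fun n => by ring

include hY hα in
-- The window length `1 / (p + 1)` is taken so small that the drift of the difference within an
-- incomplete window is at most `η / 2`; the complete windows contribute the other `η / 2`.
lemma eventually_compTime_sub_compTime (i j : Fin d) (T : ℝ) {η : ℝ} (hη : 0 < η) :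
    ∀ᶠ m in atTop, ∀ k ≥ m, aggTime α Y k - aggTime α Y m ≤ T →
      |(compTime α Y k i - compTime α Y k j) - (compTime α Y m i - compTime α Y m j)| ≤ η := by
  obtain ⟨C, hC, hCb⟩ := hY.exists_compTime_sub_le hα
  obtain ⟨p, hp⟩ := exists_nat_one_div_lt (show 0 < η / (2 * (C * 2 + 1)) by positivity)
  have hx : (0 : ℝ) < 1 / ((p : ℝ) + 1) := by positivity
  have hlip : ∀ᶠ m in atTop, ∀ k ≥ m,
      |(compTime α Y k i - compTime α Y k j) - (compTime α Y m i - compTime α Y m j)| ≤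
        C * (stepSum α k - stepSum α m) := by
    filter_upwards [hCb i, hCb j] with m h1 h2 k hk
    have h3 := compTime_mono (Y := Y) hα.pos i hk
    have h4 := compTime_mono (Y := Y) hα.pos j hk
    simp only at h3 h4
    rw [abs_le]
    constructor <;> linarith [h1 k hk, h2 k hk]
  have := eventually_abs_sub_le_of_window hx hC
    (fun n => (hα.windowEnd_spec (1 / ((p : ℝ) + 1)) n).1) (stepSum_strictMono hα.pos).monotone
    (hα.tendsto_stepSum_windowEnd hx) (hY.tendsto_compTime_window hα p i j) hlip T
    (half_pos hη)
  filter_upwards [this, hY.eventually_stepSum_sub_le hα] with m h1 h2 k hk hT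
  refine (h1 k hk ((h2 k hk).trans hT)).trans ?_
  have h3 : C * (2 * (1 / ((p : ℝ) + 1))) ≤ (C * 2 + 1) * (η / (2 * (C * 2 + 1))) := by
    nlinarith
  have h4 : (C * 2 + 1) * (η / (2 * (C * 2 + 1))) = η / 2 := by field_simp
  linarith

include hY hα in
/-- Over bounded stretches of the aggregated clock, every component clock runs asymptotically at the
same speed `1 / d`. -/
theorem eventually_compTime_sub (T : ℝ) {η : ℝ} (hη : 0 < η) :
    ∀ᶠ m in atTop, ∀ k ≥ m, aggTime α Y k - aggTime α Y m ≤ T → ∀ i,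
      |compTime α Y k i - compTime α Y m i - (aggTime α Y k - aggTime α Y m) / d| ≤ η := by
  have h : ∀ᶠ m in atTop, ∀ i j, ∀ k ≥ m, aggTime α Y k - aggTime α Y m ≤ T →
      |(compTime α Y k i - compTime α Y k j) - (compTime α Y m i - compTime α Y m j)| ≤ η :=
    eventually_all.mpr fun i => eventually_all.mpr fun j =>
      hY.eventually_compTime_sub_compTime hα i j T hη
  filter_upwards [h] with m hm k hk hT i
  have hd : (0 : ℝ) < d := by exact_mod_cast i.pos
  -- The aggregated clock is the sum of the component clocks, so the deviation of clock `i` from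
  -- their mean is the average over `j` of its deviations from clock `j`.
  have h1 : compTime α Y k i - compTime α Y m i - (aggTime α Y k - aggTime α Y m) / d =
      (∑ j, ((compTime α Y k i - compTime α Y k j) - (compTime α Y m i - compTime α Y m j))) /
        d := by
    rw [aggTime_eq, aggTime_eq]
    simp only [Finset.sum_sub_distrib, Finset.sum_const, Finset.card_univ, Fintype.card_fin,
      nsmul_eq_mul]
    field_simp
    ring
  rw [h1, abs_div, abs_of_pos hd, div_le_iff₀ hd]
  refine (Finset.abs_sum_le_sum_abs _ _).trans ?_
  refine (Finset.sum_le_sum fun j _ => hm i j k hk hT).trans ?_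
  simp [mul_comm]

end RegularUpdates

end Clocks
end AsyncSA
end

noncomputable section

namespace AsyncSA

/-! ### Tracking a differential equation -/

section Tracking

variable {d : ℕ} {α : ℕ → ℝ} {Y : ℕ → Finset (Fin d)}
  {F G : (Fin d → ℝ) → (Fin d → ℝ)} {L : NNReal}

lemma sum_Ico_aggStep {m k : ℕ} (h : m ≤ k) :
    ∑ j ∈ Finset.Ico m k, aggStep α Y j = aggTime α Y k - aggTime α Y m :=
  Finset.sum_Ico_eq_sub _ h

/-- Subtracting the tangent at `s` leaves a function with derivative `c • (G (φ u) - G (φ s))`,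
which is at most `L * V * (s' - s)` because `φ` has speed at most `V`. -/
lemma norm_sub_sub_smul_le {c V T : ℝ} {φ : ℝ → Fin d → ℝ} (hG : LipschitzWith L G)
    (hc0 : 0 ≤ c) (hc1 : c ≤ 1) (hφ : IsIntegralCurve φ (fun _ y => c • G y))
    (hV : ∀ s ∈ Icc 0 T, ‖G (φ s)‖ ≤ V) {s s' : ℝ} (hs : 0 ≤ s) (hss : s ≤ s') (hs' : s' ≤ T) :
    ‖φ s' - φ s‖ ≤ V * (s' - s) ∧
      ‖φ s' - φ s - (c * (s' - s)) • G (φ s)‖ ≤ L * V * (s' - s) * (s' - s) := by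
  have hlip : ∀ u ∈ Icc s s', ‖φ u - φ s‖ ≤ V * (u - s) := by
    intro u hu
    have := (convex_Icc s u).norm_image_sub_le_of_norm_hasDerivWithin_le (f := φ)
      (f' := fun v => c • G (φ v)) (C := V) (fun v _ => (hφ v).hasDerivWithinAt)
      (fun v hv => ?_) (left_mem_Icc.mpr hu.1) (right_mem_Icc.mpr hu.1)
    · rwa [Real.norm_of_nonneg (by linarith [hu.1])] at this
    · rw [norm_smul, Real.norm_of_nonneg hc0]
      have h1 := hV v ⟨by linarith [hv.1], by linarith [hv.2, hu.2]⟩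
      nlinarith [norm_nonneg (G (φ v))]
  refine ⟨hlip s' (right_mem_Icc.mpr hss), ?_⟩
  have hder : ∀ u ∈ Icc s s', HasDerivWithinAt (fun u => φ u - (c * u) • G (φ s))
      (c • G (φ u) - c • G (φ s)) (Icc s s') u := by
    intro u _
    have h1 : HasDerivAt (fun u : ℝ => (c * u) • G (φ s)) (c • G (φ s)) u := by
      simpa using ((hasDerivAt_id u).const_mul c).smul_const (G (φ s))
    exact ((hφ u).sub h1).hasDerivWithinAt
  have := (convex_Icc s s').norm_image_sub_le_of_norm_hasDerivWithin_le
    (C := L * V * (s' - s)) hder (fun u hu => ?_) (left_mem_Icc.mpr hss) (right_mem_Icc.mpr hss)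
  · rw [Real.norm_of_nonneg (by linarith : 0 ≤ s' - s)] at this
    refine le_trans (le_of_eq ?_) this
    congr 1
    rw [mul_sub, sub_smul]
    abel
  · rw [← smul_sub, norm_smul, Real.norm_of_nonneg hc0]
    have h1 := hG.norm_sub_le (φ u) (φ s)
    have h2 := hlip u hu
    have h3 : V * (u - s) ≤ V * (s' - s) := by
      have : 0 ≤ V := (norm_nonneg _).trans (hV s ⟨hs, hss.trans hs'⟩)
      gcongr
      exact hu.2
    calc c * ‖G (φ u) - G (φ s)‖ ≤ 1 * (L * (V * (s' - s))) := by
          gcongr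
          exact h1.trans (by gcongr; linarith)
      _ = _ := by ring

/-- An asynchronous Euler scheme for `F`, perturbed by errors with small partial sums, stays close
to a solution of `φ̇ = c G(φ)` over a bounded time horizon, as long as `F` is close to `G` along the
solution and the component clocks run at speed close to `c`. -/
theorem norm_sub_solution_le {c V T η β ϑ a : ℝ} {φ : ℝ → Fin d → ℝ} {y r : ℕ → Fin d → ℝ}
    {m n : ℕ} (hα : ∀ n, 0 < α n) (hF : LipschitzWith L F) (hG : LipschitzWith L G)
    (hc0 : 0 ≤ c) (hc1 : c ≤ 1) (hφ : IsIntegralCurve φ (fun _ y => c • G y)) (hmn : m ≤ n)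
    (hy : ∀ k, m ≤ k → k < n → ∀ i,
      y (k + 1) i = y k i + compStep α Y k i * F (y k) i + r k i)
    (hr : ∀ k, m ≤ k → k ≤ n → ∀ i, |∑ j ∈ Finset.Ico m k, r j i| ≤ ϑ)
    (hT : aggTime α Y n - aggTime α Y m ≤ T) (hV : ∀ s ∈ Icc 0 T, ‖G (φ s)‖ ≤ V)
    (hη : ∀ s ∈ Icc 0 T, ‖F (φ s) - G (φ s)‖ ≤ η)
    (hβ : ∀ k, m ≤ k → k ≤ n → ∀ i, |compTime α Y k i - compTime α Y m i -
      c * (aggTime α Y k - aggTime α Y m)| ≤ β)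
    (ha : ∀ k, m ≤ k → k < n → aggStep α Y k ≤ a) (h0 : φ 0 = y m) (hϑ : 0 ≤ ϑ) (hβ0 : 0 ≤ β)
    (ha0 : 0 ≤ a) :
    ‖y n - φ (aggTime α Y n - aggTime α Y m)‖ ≤
      (ϑ + T * η + β * (V + L * V * T) + L * V * a * T) * Real.exp (L * T) := by
  have hagg0 : ∀ k, 0 ≤ aggStep α Y k := fun k => by
    rw [aggStep_eq]; exact Finset.sum_nonneg fun i _ => compStep_nonneg hα k i
  have hmono : Monotone (aggTime α Y) :=
    monotone_nat_of_le_succ fun k => by rw [aggTime_succ]; linarith [hagg0 k]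
  set s : ℕ → ℝ := fun k => aggTime α Y k - aggTime α Y m with hs
  have hs0 : ∀ k, m ≤ k → 0 ≤ s k := fun k hk => sub_nonneg.mpr (hmono hk)
  have hsT : ∀ k, k ≤ n → s k ≤ T := fun k hk => le_trans (sub_le_sub_right (hmono hk) _) hT
  have hssucc : ∀ k, s (k + 1) = s k + aggStep α Y k := fun k => by
    simp only [hs]; rw [aggTime_succ]; ring
  have hT0 : 0 ≤ T := (hs0 n hmn).trans (hsT n le_rfl)
  have hV0 : 0 ≤ V := (norm_nonneg _).trans (hV 0 ⟨le_rfl, hT0⟩)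
  have hη0 : 0 ≤ η := (norm_nonneg _).trans (hη 0 ⟨le_rfl, hT0⟩)
  have hsum : ∀ k, m ≤ k → ∑ j ∈ Finset.Ico m k, aggStep α Y j = s k :=
    fun k hk => sum_Ico_aggStep hk
  set E : ℝ := ϑ + T * η + β * (V + L * V * T) + L * V * a * T with hE
  have hE0 : 0 ≤ E := by positivity
  set e : ℕ → ℝ := fun k => ‖y k - φ (s k)‖ with he
  have main : ∀ k, m ≤ k → k ≤ n →
      e k ≤ E + ∑ j ∈ Finset.Ico m k, aggStep α Y j * (L * e j) := by
    intro k hk hkn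
    have hsumnn : 0 ≤ ∑ j ∈ Finset.Ico m k, aggStep α Y j * (L * e j) :=
      Finset.sum_nonneg fun j _ => mul_nonneg (hagg0 j) (mul_nonneg L.coe_nonneg (norm_nonneg _))
    rw [he]
    simp only
    rw [pi_norm_le_iff_of_nonneg (by linarith)]
    intro i
    rw [Real.norm_eq_abs, Pi.sub_apply]
    set b : ℕ → ℝ := fun k => compTime α Y k i - compTime α Y m i - c * s k with hb
    set g : ℕ → ℝ := fun k => G (φ (s k)) i with hg
    -- The four terms are the drift error, the clock error, the Euler error of the solution and the
    -- perturbation. In the second, `compStep` is replaced by `c` times `aggStep`; single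
    -- differences of these are not small compared with the step, only their partial sums `b` are,
    -- hence the summation by parts.
    have hident : y k i - φ (s k) i =
        (∑ j ∈ Finset.Ico m k, compStep α Y j i * (F (y j) i - G (φ (s j)) i)) +
        (b k * g k - ∑ j ∈ Finset.Ico m k, b (j + 1) * (g (j + 1) - g j)) +
        (∑ j ∈ Finset.Ico m k,
          -(φ (s (j + 1)) - φ (s j) - (c * (s (j + 1) - s j)) • G (φ (s j))) i) +
        ∑ j ∈ Finset.Ico m k, r j i := by
      clear hsumnn
      induction k, hk using Nat.le_induction with
      | base => simp [hs, h0, hb]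
      | succ k hk ih =>
        have ih := ih (by omega)
        simp only [Finset.sum_Ico_succ_top hk]
        have e1 := hy k hk (by omega) i
        have e2 : compTime α Y (k + 1) i = compTime α Y k i + compStep α Y k i :=
          compTime_succ k i
        have e3 : b (k + 1) = b k + compStep α Y k i - c * (s (k + 1) - s k) := by
          simp only [hb]; rw [e2]; ring
        have e4 : b (k + 1) * g (k + 1) - b (k + 1) * (g (k + 1) - g k) =
            b k * g k + (compStep α Y k i - c * (s (k + 1) - s k)) * G (φ (s k)) i := by
          rw [e3]; simp only [hg]; ring
        simp only [Pi.sub_apply, Pi.smul_apply, smul_eq_mul] at ih ⊢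
        linear_combination ih + e1 - e4
    have B1 : |∑ j ∈ Finset.Ico m k, compStep α Y j i * (F (y j) i - G (φ (s j)) i)| ≤
        (∑ j ∈ Finset.Ico m k, aggStep α Y j * (L * e j)) + T * η := by
      calc _ ≤ ∑ j ∈ Finset.Ico m k, aggStep α Y j * (L * e j + η) := by
            refine (Finset.abs_sum_le_sum_abs _ _).trans (Finset.sum_le_sum fun j hj => ?_)
            rw [Finset.mem_Ico] at hj
            rw [abs_mul, abs_of_nonneg (compStep_nonneg hα j i)]
            refine mul_le_mul (compStep_le_aggStep hα j i) ?_ (abs_nonneg _) (hagg0 j)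
            have h1 := norm_le_pi_norm (F (y j) - F (φ (s j))) i
            have h2 := norm_le_pi_norm (F (φ (s j)) - G (φ (s j))) i
            have h3 := hF.norm_sub_le (y j) (φ (s j))
            have h4 := hη (s j) ⟨hs0 j hj.1, hsT j (by omega)⟩
            have h5 := abs_sub_le (F (y j) i) (F (φ (s j)) i) (G (φ (s j)) i)
            simp only [Pi.sub_apply, Real.norm_eq_abs] at h1 h2
            linarith
        _ = (∑ j ∈ Finset.Ico m k, aggStep α Y j * (L * e j)) + s k * η := by
            rw [← hsum k hk, Finset.sum_mul, ← Finset.sum_add_distrib]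
            exact Finset.sum_congr rfl fun j _ => by ring
        _ ≤ _ := by gcongr; exact hsT k hkn
    have hbb : ∀ j, m ≤ j → j ≤ n → |b j| ≤ β := fun j h1 h2 => hβ j h1 h2 i
    have B2 : |b k * g k - ∑ j ∈ Finset.Ico m k, b (j + 1) * (g (j + 1) - g j)| ≤
        β * (V + L * V * T) := by
      have h1 : |b k * g k| ≤ β * V := by
        rw [abs_mul]
        refine mul_le_mul (hbb k hk hkn) ?_ (abs_nonneg _) hβ0
        exact (norm_le_pi_norm _ i).trans (hV (s k) ⟨hs0 k hk, hsT k hkn⟩)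
      have h2 : |∑ j ∈ Finset.Ico m k, b (j + 1) * (g (j + 1) - g j)| ≤ β * (L * V * T) := by
        calc _ ≤ ∑ j ∈ Finset.Ico m k, β * (L * V) * aggStep α Y j := by
              refine (Finset.abs_sum_le_sum_abs _ _).trans (Finset.sum_le_sum fun j hj => ?_)
              rw [Finset.mem_Ico] at hj
              rw [abs_mul, mul_assoc]
              refine mul_le_mul (hbb _ (by omega) (by omega)) ?_ (abs_nonneg _) hβ0
              have h1 := norm_le_pi_norm (G (φ (s (j + 1))) - G (φ (s j))) i
              have h2 := hG.norm_sub_le (φ (s (j + 1))) (φ (s j))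
              have h3 := (norm_sub_sub_smul_le hG hc0 hc1 hφ hV (hs0 j hj.1)
                (show s j ≤ s (j + 1) by rw [hssucc]; linarith [hagg0 j])
                (hsT (j + 1) (by omega))).1
              have h4 : s (j + 1) - s j = aggStep α Y j := by rw [hssucc]; ring
              rw [h4] at h3
              simp only [Pi.sub_apply, Real.norm_eq_abs] at h1
              have h5 := mul_le_mul_of_nonneg_left h3 L.coe_nonneg
              simp only [hg]
              linarith
          _ = β * (L * V) * s k := by rw [← Finset.mul_sum, hsum k hk]
          _ ≤ β * (L * V) * T := by gcongr; exact hsT k hkn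
          _ = _ := by ring
      have h3 := abs_sub (b k * g k) (∑ j ∈ Finset.Ico m k, b (j + 1) * (g (j + 1) - g j))
      linarith
    have B3 : |∑ j ∈ Finset.Ico m k,
        -(φ (s (j + 1)) - φ (s j) - (c * (s (j + 1) - s j)) • G (φ (s j))) i| ≤
        L * V * a * T := by
      calc _ ≤ ∑ j ∈ Finset.Ico m k, L * V * a * aggStep α Y j := by
            refine (Finset.abs_sum_le_sum_abs _ _).trans (Finset.sum_le_sum fun j hj => ?_)
            rw [Finset.mem_Ico] at hj
            rw [abs_neg]
            have h3 := (norm_sub_sub_smul_le hG hc0 hc1 hφ hV (hs0 j hj.1)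
              (show s j ≤ s (j + 1) by rw [hssucc]; linarith [hagg0 j])
              (hsT (j + 1) (by omega))).2
            have h4 : s (j + 1) - s j = aggStep α Y j := by rw [hssucc]; ring
            refine ((norm_le_pi_norm _ i).trans h3).trans ?_
            rw [h4]
            have := hagg0 j
            gcongr
            exact ha j hj.1 (by omega)
        _ = L * V * a * s k := by rw [← Finset.mul_sum, hsum k hk]
        _ ≤ _ := by gcongr; exact hsT k hkn
    rw [hident]
    have B4 := hr k hk hkn i
    refine (abs_add_le _ _).trans ?_
    refine (add_le_add_left (abs_add_three _ _ _) _).trans ?_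
    linarith
  -- Discrete Grönwall, by induction on the majorant in `main` instead of the error itself, with `1
  -- + u ≤ exp u` at each step.
  have gron : ∀ k, m ≤ k → k ≤ n →
      E + ∑ j ∈ Finset.Ico m k, aggStep α Y j * (L * e j) ≤ E * Real.exp (L * s k) := by
    intro k hk
    induction k, hk using Nat.le_induction with
    | base => intro _; simp [hs]
    | succ k hk ih =>
      intro hkn
      have ih := ih (by omega)
      have h1 := main k hk (by omega)
      rw [Finset.sum_Ico_succ_top hk, hssucc, mul_add, Real.exp_add, ← mul_assoc E, ← add_assoc]
      have h2 : 1 + L * aggStep α Y k ≤ Real.exp (L * aggStep α Y k) := by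
        linarith [Real.add_one_le_exp (L * aggStep α Y k)]
      have h3 : aggStep α Y k * (L * e k) ≤
          aggStep α Y k * (L * (E * Real.exp (L * s k))) := by
        have := hagg0 k
        gcongr
        linarith
      calc _ ≤ E * Real.exp (L * s k) + aggStep α Y k * (L * (E * Real.exp (L * s k))) := by
            linarith
        _ = E * Real.exp (L * s k) * (1 + L * aggStep α Y k) := by ring
        _ ≤ _ := by gcongr
  refine (main n hmn le_rfl).trans ((gron n hmn le_rfl).trans ?_)
  gcongr

end Tracking
end AsyncSA
end

noncomputable section

namespace AsyncSA

/-! ### Convergence of the weighted noise -/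

section Noise

variable {Ω : Type*} {m0 : MeasurableSpace Ω} {μ : Measure Ω} [IsProbabilityMeasure μ]

/-- Pull-out property of the `[0, ∞]`-valued conditional expectation. -/
lemma lintegral_mul_condLExp {m : MeasurableSpace Ω} (hm : m ≤ m0) {X : Ω → ENNReal}
    (hX : Measurable[m0] X) {w : Ω → ENNReal} (hw : Measurable[m] w) :
    ∫⁻ ω, w ω * condLExp m μ X ω ∂μ = ∫⁻ ω, w ω * X ω ∂μ := by
  have hC : Measurable[m0] (condLExp m μ X) := measurable_condLExp' m μ X
  refine Measurable.ennreal_induction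
    (motive := fun w => ∫⁻ ω, w ω * condLExp m μ X ω ∂μ = ∫⁻ ω, w ω * X ω ∂μ) ?_ ?_ ?_ hw
  · intro c s hs
    have : ∀ (Z : Ω → ENNReal) ω,
        s.indicator (fun _ => c) ω * Z ω = s.indicator (fun ω => c * Z ω) ω := by
      intro Z ω
      by_cases h : ω ∈ s <;> simp [h]
    simp only [this]
    rw [lintegral_indicator (hm s hs), lintegral_indicator (hm s hs), lintegral_const_mul _ hC,
      lintegral_const_mul _ hX, setLIntegral_condLExp hm μ X hs]
  · intro f g _ hf hg hf' hg'
    have hf0 : Measurable[m0] f := hf.mono hm le_rfl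
    simp only [Pi.add_apply, add_mul]
    rw [lintegral_add_left (f := fun ω => f ω * condLExp m μ X ω) (hf0.mul hC),
      lintegral_add_left (f := fun ω => f ω * X ω) (hf0.mul hX), hf', hg']
  · intro f hf hmono ih
    have hf0 : ∀ n, Measurable[m0] (f n) := fun n => (hf n).mono hm le_rfl
    simp only [ENNReal.iSup_mul]
    rw [lintegral_iSup (f := fun n ω => f n ω * condLExp m μ X ω) (fun n => (hf0 n).mul hC)
      (fun a b hab ω => mul_le_mul_left (hmono hab ω) _),
      lintegral_iSup (f := fun n ω => f n ω * X ω) (fun n => (hf0 n).mul hX)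
      (fun a b hab ω => mul_le_mul_left (hmono hab ω) _)]
    simp only [ih]

/-- A martingale with square-summable increments converges almost surely. -/
lemma ae_exists_tendsto_sum_of_sq_summable {ℱ : Filtration ℕ m0} {ξ : ℕ → Ω → ℝ} {C : ℝ}
    (hξ : ∀ n, Measurable[ℱ (n + 1)] (ξ n)) (hL2 : ∀ n, MemLp (ξ n) 2 μ)
    (hcent : ∀ n, μ[ξ n | ℱ n] =ᵐ[μ] 0)
    (hC : ∀ n, ∑ k ∈ Finset.range n, ∫ ω, ξ k ω ^ 2 ∂μ ≤ C) :
    ∀ᵐ ω ∂μ, ∃ l, Tendsto (fun n => ∑ k ∈ Finset.range n, ξ k ω) atTop (𝓝 l) := by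
  set Z : ℕ → Ω → ℝ := fun n ω => ∑ k ∈ Finset.range n, ξ k ω with hZ
  have hadp : StronglyAdapted ℱ Z := by
    intro n
    refine Measurable.stronglyMeasurable ?_
    refine Finset.measurable_sum _ fun k hk => ?_
    exact (hξ k).mono (ℱ.mono (by simpa using hk)) le_rfl
  have hZ2 : ∀ n, MemLp (Z n) 2 μ := fun n => memLp_finsetSum _ fun k _ => hL2 k
  have hint : ∀ n, Integrable (Z n) μ := fun n => (hZ2 n).integrable (by norm_num)
  have hsucc : ∀ n, Z (n + 1) = Z n + ξ n := fun n => by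
    funext ω; exact Finset.sum_range_succ _ _
  have hmart : Martingale Z ℱ μ := by
    refine martingale_of_condExp_sub_eq_zero_nat hadp hint fun n => ?_
    rw [hsucc, add_sub_cancel_left]
    exact hcent n
  -- Increments are orthogonal to the past, so second moments add up. This bounds `Z` in L², hence
  -- in L¹ by `|z| ≤ 1 + z²`, and Doob's convergence theorem applies.
  have hcross : ∀ n, ∫ ω, Z n ω * ξ n ω ∂μ = 0 := by
    intro n
    have hprod : Integrable (Z n * ξ n) μ := (hZ2 n).integrable_mul (hL2 n)
    have h1 := condExp_mul_of_stronglyMeasurable_left (hadp n) hprod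
      ((hL2 n).integrable (by norm_num))
    have h2 : μ[Z n * ξ n | ℱ n] =ᵐ[μ] 0 := by
      filter_upwards [h1, hcent n] with ω h3 h4
      rw [h3, Pi.mul_apply, h4]; simp
    change ∫ ω, (Z n * ξ n) ω ∂μ = 0
    rw [← integral_condExp (ℱ.le n), integral_congr_ae h2]
    simp
  have hsq : ∀ n, ∫ ω, Z n ω ^ 2 ∂μ = ∑ k ∈ Finset.range n, ∫ ω, ξ k ω ^ 2 ∂μ := by
    intro n
    induction n with
    | zero => simp [hZ]
    | succ n ih =>
      rw [Finset.sum_range_succ, ← ih]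
      have h1 : ∀ ω, Z (n + 1) ω ^ 2 = Z n ω ^ 2 + 2 * (Z n ω * ξ n ω) + ξ n ω ^ 2 := by
        intro ω; rw [hsucc, Pi.add_apply]; ring
      have i1 : Integrable (fun ω => Z n ω ^ 2) μ := (hZ2 n).integrable_sq
      have i2 : Integrable (fun ω => 2 * (Z n ω * ξ n ω)) μ :=
        ((hZ2 n).integrable_mul (hL2 n)).const_mul 2
      have i3 : Integrable (fun ω => ξ n ω ^ 2) μ := (hL2 n).integrable_sq
      simp only [h1]
      rw [integral_add (f := fun ω => Z n ω ^ 2 + 2 * (Z n ω * ξ n ω)) (i1.add i2) i3,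
        integral_add i1 i2, integral_const_mul, hcross]
      ring
  have hbdd : ∀ n, eLpNorm (Z n) 1 μ ≤ (1 + C).toNNReal := by
    intro n
    rw [eLpNorm_one_eq_lintegral_enorm, ← ofReal_integral_norm_eq_lintegral_enorm (hint n)]
    refine ENNReal.ofReal_le_ofReal ?_
    calc ∫ ω, ‖Z n ω‖ ∂μ ≤ ∫ ω, (1 + Z n ω ^ 2) ∂μ := by
          refine integral_mono (hint n).norm ((integrable_const 1).add (hZ2 n).integrable_sq) ?_
          intro ω
          simp only [Real.norm_eq_abs]
          nlinarith [sq_abs (Z n ω), sq_nonneg (|Z n ω| - 1)]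
      _ = 1 + ∑ k ∈ Finset.range n, ∫ ω, ξ k ω ^ 2 ∂μ := by
          rw [integral_add (integrable_const 1) (hZ2 n).integrable_sq, hsq]; simp
      _ ≤ 1 + C := by linarith [hC n]
  filter_upwards [hmart.submartingale.ae_tendsto_limitProcess hbdd] with ω hω
  exact ⟨_, hω⟩

/-- Weighted sums of centered noise converge almost surely when the weighted conditional variances
are almost surely bounded up to square-summable factors. -/
theorem ae_exists_tendsto_sum_mul_noise {ℱ : Filtration ℕ m0} {A B : ℝ} {a w v ξ : ℕ → Ω → ℝ}
    (ha : Adapted ℱ a) (hw : Adapted ℱ w) (hv : Adapted ℱ v)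
    (hξ : ∀ n, Measurable[ℱ (n + 1)] (ξ n)) (hint : ∀ n, Integrable (ξ n) μ)
    (hcent : ∀ n, μ[ξ n | ℱ n] =ᵐ[μ] 0)
    (hvar : ∀ n, ∀ᵐ ω ∂μ,
      condLExp (ℱ n) μ (fun ω' => ENNReal.ofReal (ξ n ω' ^ 2)) ω ≤ ENNReal.ofReal (v n ω))
    (hA : ∀ n ω, ∑ k ∈ Finset.range n, a k ω ^ 2 ≤ A) (hB : ∀ n ω, |w n ω| ≤ B)
    (hbdd : ∀ᵐ ω ∂μ, BddAbove (range fun n => w n ω ^ 2 * v n ω)) :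
    ∀ᵐ ω ∂μ, ∃ l, Tendsto (fun n => ∑ k ∈ Finset.range n, a k ω * w k ω * ξ k ω)
      atTop (𝓝 l) := by
  -- The coefficient is dropped wherever `w² v` exceeds `N`. This event is known at time `n`, so the
  -- truncated terms are still centered, and their second moments are at most those of `√N * a`. On
  -- a path where `w² v` is bounded, some `N` truncates nothing.
  set c : ℕ → ℕ → Ω → ℝ := fun N n ω =>
    if w n ω ^ 2 * v n ω ≤ N then a n ω * w n ω else 0 with hc
  have hcm : ∀ N n, Measurable[ℱ n] (c N n) := fun N n =>
    Measurable.ite (measurableSet_le (((hw n).pow_const 2).mul (hv n)) measurable_const)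
      ((ha n).mul (hw n)) measurable_const
  have hasq : ∀ n ω, a n ω ^ 2 ≤ A := fun n ω =>
    (Finset.single_le_sum (f := fun k => a k ω ^ 2) (fun k _ => sq_nonneg _)
      (Finset.self_mem_range_succ n)).trans (hA (n + 1) ω)
  have hcb : ∀ N n ω, |c N n ω| ≤ Real.sqrt A * B := by
    intro N n ω
    have h1 : |a n ω| ≤ Real.sqrt A := Real.abs_le_sqrt (hasq n ω)
    have hB0 : 0 ≤ B := (abs_nonneg _).trans (hB n ω)
    simp only [hc]
    split_ifs
    · rw [abs_mul]
      exact mul_le_mul h1 (hB n ω) (abs_nonneg _) (Real.sqrt_nonneg _)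
    · simp; positivity
  have hξ0 : ∀ n, Measurable (ξ n) := fun n => (hξ n).mono (ℱ.le _) le_rfl
  have hc0 : ∀ N n, Measurable (c N n) := fun N n => (hcm N n).mono (ℱ.le _) le_rfl
  have ha0 : ∀ n, Measurable (a n) := fun n => (ha n).mono (ℱ.le _) le_rfl
  have hlint : ∀ N n, ∫⁻ ω, ENNReal.ofReal ((c N n ω * ξ n ω) ^ 2) ∂μ ≤
      ∫⁻ ω, ENNReal.ofReal (N * a n ω ^ 2) ∂μ := by
    intro N n
    have e1 : ∀ ω, ENNReal.ofReal ((c N n ω * ξ n ω) ^ 2) =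
        ENNReal.ofReal (c N n ω ^ 2) * ENNReal.ofReal (ξ n ω ^ 2) := by
      intro ω; rw [mul_pow, ENNReal.ofReal_mul (sq_nonneg _)]
    simp only [e1]
    rw [← lintegral_mul_condLExp (ℱ.le n) (X := fun ω => ENNReal.ofReal (ξ n ω ^ 2))
      ((hξ0 n).pow_const 2).ennreal_ofReal ((hcm N n).pow_const 2).ennreal_ofReal]
    refine lintegral_mono_ae ?_
    filter_upwards [hvar n] with ω hω
    refine (mul_le_mul_right hω _).trans ?_
    rw [← ENNReal.ofReal_mul (sq_nonneg _)]
    refine ENNReal.ofReal_le_ofReal ?_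
    simp only [hc]
    split_ifs with h
    · calc (a n ω * w n ω) ^ 2 * v n ω = a n ω ^ 2 * (w n ω ^ 2 * v n ω) := by ring
        _ ≤ a n ω ^ 2 * N := by gcongr
        _ = _ := by ring
    · simp; positivity
  have haint : ∀ N n : ℕ, Integrable (fun ω => (N : ℝ) * a n ω ^ 2) μ := by
    intro N n
    refine Integrable.of_bound (((ha0 n).pow_const 2).const_mul _).aestronglyMeasurable (N * A)
      (Eventually.of_forall fun ω => ?_)
    rw [Real.norm_of_nonneg (by positivity)]
    gcongr
    exact hasq n ω
  have hfin : ∀ N n : ℕ, ∫⁻ ω, ENNReal.ofReal ((c N n ω * ξ n ω) ^ 2) ∂μ < ⊤ := fun N n =>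
    (hlint N n).trans_lt (haint N n).lintegral_lt_top
  have hmeas : ∀ N n, Measurable fun ω => c N n ω * ξ n ω := fun N n => (hc0 N n).mul (hξ0 n)
  have hsqint : ∀ N n, Integrable (fun ω => (c N n ω * ξ n ω) ^ 2) μ := fun N n =>
    (lintegral_ofReal_ne_top_iff_integrable ((hmeas N n).pow_const 2).aestronglyMeasurable
      (Eventually.of_forall fun ω => sq_nonneg _)).mp (hfin N n).ne
  have hint2 : ∀ N n, ∫ ω, (c N n ω * ξ n ω) ^ 2 ∂μ ≤ ∫ ω, (N : ℝ) * a n ω ^ 2 ∂μ := by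
    intro N n
    rw [integral_eq_lintegral_of_nonneg_ae (Eventually.of_forall fun ω => sq_nonneg _)
      (hsqint N n).aestronglyMeasurable,
      integral_eq_lintegral_of_nonneg_ae (Eventually.of_forall fun ω => by positivity)
      (haint N n).aestronglyMeasurable]
    exact ENNReal.toReal_mono (haint N n).lintegral_lt_top.ne (hlint N n)
  have hconv : ∀ N : ℕ, ∀ᵐ ω ∂μ, ∃ l,
      Tendsto (fun n => ∑ k ∈ Finset.range n, c N k ω * ξ k ω) atTop (𝓝 l) := by
    intro N
    refine ae_exists_tendsto_sum_of_sq_summable (ℱ := ℱ) (C := N * A)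
      (ξ := fun n ω => c N n ω * ξ n ω)
      (fun n => ((hcm N n).mono (ℱ.mono n.le_succ) le_rfl).mul (hξ n))
      (fun n => (memLp_two_iff_integrable_sq (hmeas N n).aestronglyMeasurable).mpr (hsqint N n))
      (fun n => ?_) (fun n => ?_)
    · have h1 := condExp_stronglyMeasurable_mul_of_bound (ℱ.le n) (hcm N n).stronglyMeasurable
        (hint n) _ (Eventually.of_forall (hcb N n))
      filter_upwards [h1, hcent n] with ω h2 h3
      change (μ[c N n * ξ n | ℱ n]) ω = 0
      rw [h2, Pi.mul_apply, h3]; simp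
    · refine (Finset.sum_le_sum fun k _ => hint2 N k).trans ?_
      rw [← integral_finsetSum _ fun k _ => haint N k]
      have : ∀ ω, ∑ k ∈ Finset.range n, (N : ℝ) * a k ω ^ 2 ≤ N * A := by
        intro ω
        rw [← Finset.mul_sum]
        gcongr
        exact hA n ω
      refine (integral_mono (integrable_finsetSum _ fun k _ => haint N k)
        (integrable_const (N * A)) this).trans ?_
      simp
  filter_upwards [ae_all_iff.mpr hconv, hbdd] with ω h1 h2
  obtain ⟨C, hC⟩ := h2
  obtain ⟨N, hN⟩ := exists_nat_ge C
  obtain ⟨l, hl⟩ := h1 N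
  refine ⟨l, hl.congr fun n => Finset.sum_congr rfl fun k _ => ?_⟩
  simp only [hc]
  rw [if_pos ((hC ⟨k, rfl⟩).trans hN)]

end Noise
end AsyncSA
end

noncomputable section

namespace AsyncSA

/-! ### Stability -/

section Stability

/-- The time elapsed since the last renormalization, and the current normalizer: after a stretch of
length `T` of the clock with increments `a`, the normalizer is reset to `max R ‖x k‖`. -/
def normState {d : ℕ} (R T : ℝ) (a : ℕ → ℝ) (x : ℕ → Fin d → ℝ) : ℕ → ℝ × ℝ
  | 0 => (0, max R ‖x 0‖)
  | k + 1 => if T ≤ (normState R T a x k).1 + a k then (0, max R ‖x (k + 1)‖)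
      else ((normState R T a x k).1 + a k, (normState R T a x k).2)

/-- The weight that normalizes the noise as long as the iterate is at most `B` times the
normalizer. -/
def normWeight {d : ℕ} (R T B : ℝ) (a : ℕ → ℝ) (x : ℕ → Fin d → ℝ) (k : ℕ) : ℝ :=
  if ‖x k‖ ≤ B * (normState R T a x k).2 then (normState R T a x k).2⁻¹ else 0

variable {d : ℕ} {h hinf : (Fin d → ℝ) → (Fin d → ℝ)} {L : NNReal}

lemma le_normState_snd {R T : ℝ} {a : ℕ → ℝ} {x : ℕ → Fin d → ℝ} (k : ℕ) :
    R ≤ (normState R T a x k).2 := by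
  induction k with
  | zero => exact le_max_left _ _
  | succ k ih =>
    rw [normState]
    split_ifs
    exacts [le_max_left _ _, ih]

lemma lipschitzWith_rescale (hh : LipschitzWith L h) {c : ℝ} (hc : 0 < c) :
    LipschitzWith L fun y => c⁻¹ • h (c • y) := by
  refine LipschitzWith.of_dist_le_mul fun u v => ?_
  rw [dist_eq_norm, dist_eq_norm, ← smul_sub, norm_smul, Real.norm_of_nonneg (by positivity)]
  have h1 := hh.norm_sub_le (c • u) (c • v)
  rw [← smul_sub, norm_smul, Real.norm_of_nonneg hc.le] at h1
  calc c⁻¹ * ‖h (c • u) - h (c • v)‖ ≤ c⁻¹ * (L * (c * ‖u - v‖)) := by gcongr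
    _ = L * ‖u - v‖ := by field_simp

lemma lipschitzWith_of_scaling (hh : LipschitzWith L h)
    (hlim : ∀ S : Set (Fin d → ℝ), IsCompact S →
      TendstoUniformlyOn (fun (c : ℝ) y => c⁻¹ • h (c • y)) hinf atTop S) :
    LipschitzWith L hinf := by
  have hpt : ∀ y, Tendsto (fun c : ℝ => c⁻¹ • h (c • y)) atTop (𝓝 (hinf y)) := fun y =>
    (hlim {y} isCompact_singleton).tendsto_at (mem_singleton y)
  refine LipschitzWith.of_dist_le_mul fun u v => ?_
  refine le_of_tendsto ((hpt u).dist (hpt v)) ?_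
  filter_upwards [eventually_gt_atTop 0] with c hc
  exact (lipschitzWith_rescale hh hc).dist_le_mul u v

/-- If `T` is not reached again, the clock has bounded range; so normalizations recur. -/
lemma exists_normState_reset {R T : ℝ} {a : ℕ → ℝ} {x : ℕ → Fin d → ℝ}
    (ha : Tendsto (fun n => ∑ k ∈ Finset.range n, a k) atTop atTop) (K : ℕ) :
    ∃ m ≥ K, normState R T a x m = (0, max R ‖x m‖) := by
  by_contra! hcon
  have hno : ∀ k ≥ K, ¬ T ≤ (normState R T a x k).1 + a k := by
    intro k hk hT
    exact hcon (k + 1) (by omega) (by rw [normState, if_pos hT])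
  have hs : ∀ k ≥ K, (normState R T a x k).1 = (normState R T a x K).1 +
      (∑ j ∈ Finset.range k, a j - ∑ j ∈ Finset.range K, a j) := by
    intro k hk
    induction k, hk using Nat.le_induction with
    | base => ring
    | succ k hk ih =>
      rw [normState, if_neg (hno k hk), Finset.sum_range_succ]
      simp only
      rw [ih]
      ring
  obtain ⟨k, hk1, hk2⟩ := (((ha.comp (tendsto_add_atTop_nat 1)).eventually_ge_atTop
    (T - (normState R T a x K).1 + ∑ j ∈ Finset.range K, a j)).and (eventually_ge_atTop K)).exists
  have h2 := hno k hk2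
  have h3 := hs k hk2
  simp only [Function.comp, Finset.sum_range_succ] at hk1
  linarith

/-- The normalizer and its parameters can be chosen such that the iterates are bounded as soon as
the normalized noise is summable. -/
theorem exists_normalization (hd : 0 < d) (hh : DriftConditions h) :
    ∃ R T B : ℝ, 1 ≤ R ∧ 0 < B ∧ ∀ (α : ℕ → ℝ) (Y : ℕ → Finset (Fin d))
      (x M ε : ℕ → Fin d → ℝ) (δ : ℕ → ℝ), StepsizeConditions α → RegularUpdates α Y →
      (∀ n i, x (n + 1) i = x n i +
        compStep α Y n i * (h (x n) i + M (n + 1) i + ε (n + 1) i)) →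
      Tendsto δ atTop (𝓝 0) → (∀ n, ‖ε (n + 1)‖ ≤ δ (n + 1) * (1 + ‖x n‖)) →
      (∀ i, ∃ l, Tendsto (fun n => ∑ k ∈ Finset.range n,
        compStep α Y k i * normWeight R T B (aggStep α Y) x k * M (k + 1) i) atTop (𝓝 l)) →
      ∃ C, ∀ n, ‖x n‖ ≤ C := by
  obtain ⟨L, hL⟩ := hh.lipschitz
  obtain ⟨hinf, hlim, hgas⟩ := hh.scaling
  have hLinf : LipschitzWith L hinf := lipschitzWith_of_scaling hL hlim
  have hex : ∃ L, LipschitzWith L hinf := ⟨L, hLinf⟩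
  obtain ⟨T₀, hT₀, hT₀'⟩ := hgas.exists_uniform_time hex (ε := 1 / 4) (by norm_num)
  have hdR : (0 : ℝ) < d := by exact_mod_cast hd
  have hd1 : (1 : ℝ) ≤ d := by exact_mod_cast hd
  set c : ℝ := 1 / d with hc
  have hc0 : 0 < c := by positivity
  have hc1 : c ≤ 1 := by rw [hc, div_le_one hdR]; exact hd1
  -- Component clocks run at `1 / d` of the aggregated clock, so flow time `T₀` takes `d * T₀`. The
  -- extra unit in `T₁` absorbs the step that overshoots `T` at a reset.
  set T : ℝ := d * T₀ with hTdef
  have hTpos : 0 < T := by positivity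
  set T₁ : ℝ := T + 1 with hT₁
  have hT₁pos : 0 < T₁ := by positivity
  obtain ⟨B₀, hB₀, hB₀'⟩ := exists_norm_flow_le hex 1 T₁
  set V : ℝ := L * B₀ + ‖hinf 0‖ with hV
  have hV0 : 0 ≤ V := by positivity
  set e : ℝ := Real.exp (L * T₁) with he
  have he0 : 0 < e := Real.exp_pos _
  -- With all four error parameters equal to `κ`, the bound of `norm_sub_solution_le` is at most `1
  -- / 4`.
  set κ : ℝ := 1 / (16 * e * (1 + T₁ + (V + L * V * T₁) + L * V * T₁)) with hκ
  have hden : 0 < 1 + T₁ + (V + L * V * T₁) + L * V * T₁ := by positivity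
  have hκ0 : 0 < κ := by positivity
  have hκsum : (κ + T₁ * κ + κ * (V + L * V * T₁) + L * V * κ * T₁) * e ≤ 1 / 4 := by
    have : (κ + T₁ * κ + κ * (V + L * V * T₁) + L * V * κ * T₁) * e =
        κ * (16 * e * (1 + T₁ + (V + L * V * T₁) + L * V * T₁)) / 16 := by ring
    rw [this, hκ, one_div_mul_cancel (by positivity)]
    norm_num
  obtain ⟨R₀, hR₀⟩ := eventually_atTop.mp (Metric.tendstoUniformlyOn_iff.mp
    (hlim (Metric.closedBall 0 B₀) (isCompact_closedBall _ _)) κ hκ0)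
  set R : ℝ := max R₀ 1 with hR
  set B : ℝ := B₀ + 1 with hB
  refine ⟨R, T, B, le_max_right _ _, by positivity, ?_⟩
  intro α Y x M ε δ hα hY hx hδ hε hnoise
  set ζ : ℕ → Fin d → ℝ := fun n i => ∑ k ∈ Finset.range n,
    compStep α Y k i * normWeight R T B (aggStep α Y) x k * M (k + 1) i with hζ
  set st : ℕ → ℝ × ℝ := normState R T (aggStep α Y) x with hst
  -- Half of `κ` is reserved for the tails of the noise sums, half for the bias. While `‖x‖ ≤ B ρ`
  -- and `1 ≤ ρ`, the normalized bias adds up to at most `T₁ * ρ' * (1 + B) = κ / 2`.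
  set ρ' : ℝ := κ / (2 * ((1 + B) * T₁)) with hρ'
  have hB1 : 0 < (1 + B) * T₁ := by positivity
  have hcauchy : ∀ i, ∀ᶠ m in atTop, ∀ k ≥ m, |ζ k i - ζ m i| ≤ κ / 2 := by
    intro i
    obtain ⟨l, hl⟩ := hnoise i
    obtain ⟨K, hK⟩ := Metric.cauchySeq_iff.mp hl.cauchySeq (κ / 2) (by positivity)
    filter_upwards [eventually_ge_atTop K] with m hm k hk
    have := hK k (by omega) m hm
    rw [Real.dist_eq] at this
    exact this.le
  have hδ' : ∀ᶠ m in atTop, ∀ k ≥ m, δ (k + 1) ≤ ρ' := by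
    obtain ⟨K, hK⟩ := eventually_atTop.mp (hδ.eventually_le_const (show 0 < ρ' by positivity))
    filter_upwards [eventually_ge_atTop K] with m hm k hk
    exact hK _ (by omega)
  have hagg : ∀ᶠ m in atTop, ∀ k ≥ m, aggStep α Y k ≤ min κ 1 := by
    obtain ⟨K, hK⟩ := eventually_atTop.mp ((hα.tendsto_aggStep (Y := Y)).eventually_le_const
      (show 0 < min κ 1 by positivity))
    filter_upwards [eventually_ge_atTop K] with m hm k hk
    exact hK _ (by omega)
  obtain ⟨K, hK⟩ := eventually_atTop.mp ((eventually_all.mpr hcauchy).and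
    (hδ'.and (hagg.and (hY.eventually_compTime_sub hα T₁ hκ0))))
  have hmono := (aggTime_strictMono hα.pos hY.nonempty).monotone
  -- within a window, the normalized iterates track the limiting equation
  have window : ∀ m ≥ K, ∀ n ≥ m, aggTime α Y n - aggTime α Y m ≤ T₁ →
      (∀ j, m ≤ j → j < n → (st j).2 = max R ‖x m‖) →
      ‖(max R ‖x m‖)⁻¹ • x n - flow hinf hex ((max R ‖x m‖)⁻¹ • x m)
        ((aggTime α Y n - aggTime α Y m) * c)‖ ≤ 1 / 4 ∧ ‖x n‖ ≤ B * max R ‖x m‖ := by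
    intro m hm n
    obtain ⟨hK1, hK2, hK3, hK4⟩ := hK m hm
    set ρ : ℝ := max R ‖x m‖ with hρ
    have hρR : R ≤ ρ := le_max_left _ _
    have hρ1 : 1 ≤ ρ := (le_max_right R₀ 1).trans hρR
    have hρ0 : 0 < ρ := by linarith
    set p : Fin d → ℝ := ρ⁻¹ • x m with hp
    have hp1 : ‖p‖ ≤ 1 := by
      rw [hp, norm_smul, norm_inv, Real.norm_of_nonneg hρ0.le, inv_mul_le_one₀ hρ0]
      exact le_max_right _ _
    have hφB : ∀ s ∈ Icc 0 T₁, ‖flow hinf hex p (s * c)‖ ≤ B₀ := fun s hs =>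
      hB₀' p hp1 _ (by
        rw [abs_of_nonneg (mul_nonneg hs.1 hc0.le)]
        nlinarith [hs.1, hs.2])
    -- The weights equal `ρ⁻¹` only while `‖x j‖ ≤ B * ρ`. Tracking up to `n` uses the weights
    -- before `n` alone, and then gives this bound at `n`, since `B = B₀ + 1` exceeds the bound on
    -- the flow by more than the error `1 / 4`.
    induction n using Nat.strong_induction_on with
    | _ n ih =>
    intro hn hnT hstn
    have hprev : ∀ j, m ≤ j → j < n → ‖x j‖ ≤ B * ρ := fun j hj hjn =>
      (ih j hjn hj (by linarith [hmono hjn.le]) fun k h1 h2 => hstn k h1 (by omega)).2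
    have htrack := norm_sub_solution_le (F := fun y => ρ⁻¹ • h (ρ • y)) (G := hinf) (c := c)
      (V := V) (T := T₁) (η := κ) (β := κ) (ϑ := κ) (a := κ)
      (φ := fun s => flow hinf hex p (s * c)) (y := fun k => ρ⁻¹ • x k)
      (r := fun k i => compStep α Y k i * (ρ⁻¹ * (M (k + 1) i + ε (k + 1) i)))
      (m := m) (n := n) hα.pos (lipschitzWith_rescale hL hρ0) hLinf hc0.le hc1
      ((isIntegralCurve_flow hex p).comp_mul c) hn
      (by
        intro k _ _ i
        simp only [Pi.smul_apply, smul_eq_mul, smul_inv_smul₀ hρ0.ne', hx]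
        ring)
      (by
        intro k hmk hkn i
        have e1 : ∑ j ∈ Finset.Ico m k,
            compStep α Y j i * (ρ⁻¹ * (M (j + 1) i + ε (j + 1) i)) =
            (ζ k i - ζ m i) + ∑ j ∈ Finset.Ico m k, compStep α Y j i * (ρ⁻¹ * ε (j + 1) i) := by
          rw [hζ]
          simp only
          rw [← Finset.sum_Ico_eq_sub _ hmk, ← Finset.sum_add_distrib]
          refine Finset.sum_congr rfl fun j hj => ?_
          rw [Finset.mem_Ico] at hj
          have h1 : (normState R T (aggStep α Y) x j).2 = ρ := hstn j hj.1 (by omega)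
          rw [normWeight, h1, if_pos (hprev j hj.1 (by omega))]
          ring
        have e2 : |∑ j ∈ Finset.Ico m k, compStep α Y j i * (ρ⁻¹ * ε (j + 1) i)| ≤ κ / 2 := by
          calc _ ≤ ∑ j ∈ Finset.Ico m k, aggStep α Y j * (ρ' * (1 + B)) := by
                refine (Finset.abs_sum_le_sum_abs _ _).trans (Finset.sum_le_sum fun j hj => ?_)
                rw [Finset.mem_Ico] at hj
                rw [abs_mul, abs_of_nonneg (compStep_nonneg hα.pos j i)]
                refine mul_le_mul (compStep_le_aggStep hα.pos j i) ?_ (abs_nonneg _)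
                  (aggStep_pos hα.pos hY.nonempty j).le
                rw [abs_mul, abs_of_pos (inv_pos.mpr hρ0), inv_mul_le_iff₀ hρ0]
                have h1 : |ε (j + 1) i| ≤ ‖ε (j + 1)‖ := norm_le_pi_norm (ε (j + 1)) i
                have h2 := hε j
                have h3 : δ (j + 1) * (1 + ‖x j‖) ≤ ρ' * (1 + ‖x j‖) := by
                  gcongr
                  exact hK2 j hj.1
                have h4 : ρ' * (1 + ‖x j‖) ≤ ρ' * (ρ + B * ρ) := by
                  have := hprev j hj.1 (by omega)
                  gcongr
                calc _ ≤ ρ' * (ρ + B * ρ) := by linarith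
                  _ = _ := by ring
            _ = (aggTime α Y k - aggTime α Y m) * (ρ' * (1 + B)) := by
                rw [← Finset.sum_mul, sum_Ico_aggStep hmk]
            _ ≤ T₁ * (ρ' * (1 + B)) := by
                gcongr
                linarith [hmono hkn]
            _ = κ / 2 := by
                have : 1 + B ≠ 0 := by positivity
                rw [hρ']; field_simp
        rw [e1]
        refine (abs_add_le _ _).trans ?_
        linarith [hK1 i k hmk])
      hnT
      (fun s hs => (norm_le_of_lipschitzWith hLinf _).trans (by
        have := hφB s hs
        rw [hV]
        gcongr))
      (fun s hs => by
        have := hR₀ ρ ((le_max_left R₀ 1).trans hρR) (flow hinf hex p (s * c))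
          (mem_closedBall_zero_iff.mpr (hφB s hs))
        rw [dist_comm, dist_eq_norm] at this
        exact this.le)
      (fun k hmk hkn i => by
        have := hK4 k hmk (by linarith [hmono hkn]) i
        rwa [div_eq_mul_one_div, mul_comm _ (1 / (d : ℝ))] at this)
      (fun k hmk _ => (hK3 k hmk).trans (min_le_left _ _)) (by simp [hp]) hκ0.le hκ0.le hκ0.le
    have h14 := htrack.trans hκsum
    refine ⟨h14, ?_⟩
    have h1 := hφB (aggTime α Y n - aggTime α Y m) ⟨by linarith [hmono hn], hnT⟩
    have h2 := norm_le_norm_sub_add (ρ⁻¹ • x n)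
      (flow hinf hex p ((aggTime α Y n - aggTime α Y m) * c))
    have h3 : ‖ρ⁻¹ • x n‖ ≤ B := by linarith
    rw [norm_smul, norm_inv, Real.norm_of_nonneg hρ0.le, inv_mul_le_iff₀ hρ0] at h3
    linarith
  obtain ⟨m₀, hm₀, hreset⟩ := exists_normState_reset (R := R) (T := T) (x := x)
    (a := aggStep α Y) (hY.tendsto_aggTime hα) K
  -- the normalizers do not increase after `m₀`
  have inv : ∀ k ≥ m₀, ∃ m, K ≤ m ∧ m ≤ k ∧
      (∀ j, m ≤ j → j ≤ k → (st j).2 = max R ‖x m‖) ∧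
      (st k).1 = aggTime α Y k - aggTime α Y m ∧ (st k).1 < T ∧
      max R ‖x m‖ ≤ max R ‖x m₀‖ := by
    intro k hk
    induction k, hk using Nat.le_induction with
    | base =>
      refine ⟨m₀, hm₀, le_rfl, fun j h1 h2 => ?_, ?_, ?_, le_rfl⟩
      · rw [show j = m₀ by omega, hst, hreset]
      · rw [hst, hreset]; simp
      · rw [hst, hreset]; exact hTpos
    | succ k hk ih =>
      obtain ⟨m, hKm, hmk, hρm, hsm, hsT, hle⟩ := ih
      by_cases hreset' : T ≤ (st k).1 + aggStep α Y k
      · have hst' : st (k + 1) = (0, max R ‖x (k + 1)‖) := by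
          rw [hst, normState, if_pos hreset']
        have hsk : aggTime α Y (k + 1) - aggTime α Y m = (st k).1 + aggStep α Y k := by
          rw [aggTime_succ, hsm]; ring
        have ha1 : aggStep α Y k ≤ 1 := ((hK m hKm).2.2.1 k hmk).trans (min_le_right _ _)
        -- At the reset the tracking error is at most `1 / 4` and the flow, after time at least
        -- `T₀`, is below `1 / 4`. So `‖x (k + 1)‖` is at most the old normalizer, and the new one
        -- is no larger.
        have hw := (window m hKm (k + 1) (by omega) (by rw [hsk]; linarith)
          (fun j h1 h2 => hρm j h1 (by omega))).1
        have hρ0 : 0 < max R ‖x m‖ := lt_of_lt_of_le (by positivity) (le_max_left _ _)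
        have hp1 : ‖(max R ‖x m‖)⁻¹ • x m‖ ≤ 1 := by
          rw [norm_smul, norm_inv, Real.norm_of_nonneg hρ0.le, inv_mul_le_one₀ hρ0]
          exact le_max_right _ _
        have hflow := hT₀' _ hp1 ((aggTime α Y (k + 1) - aggTime α Y m) * c) (by
          rw [hsk, hc, mul_one_div, ge_iff_le, le_div_iff₀ hdR]
          linarith)
        have h2 := norm_le_norm_sub_add ((max R ‖x m‖)⁻¹ • x (k + 1))
          (flow hinf hex ((max R ‖x m‖)⁻¹ • x m) ((aggTime α Y (k + 1) - aggTime α Y m) * c))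
        have h3 : ‖(max R ‖x m‖)⁻¹ • x (k + 1)‖ ≤ 1 := by linarith
        rw [norm_smul, norm_inv, Real.norm_of_nonneg hρ0.le, inv_mul_le_one₀ hρ0] at h3
        refine ⟨k + 1, by omega, le_rfl, fun j h1 h2 => ?_, ?_, ?_, ?_⟩
        · rw [show j = k + 1 by omega, hst']
        · rw [hst']; simp
        · rw [hst']; exact hTpos
        · exact (max_le (le_max_left _ _) h3).trans hle
      · have hst' : st (k + 1) = ((st k).1 + aggStep α Y k, (st k).2) := by
          rw [hst, normState, if_neg hreset']
        refine ⟨m, hKm, by omega, fun j h1 h2 => ?_, ?_, ?_, hle⟩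
        · rcases Nat.lt_or_ge k j with h3 | h3
          · rw [show j = k + 1 by omega, hst']
            exact hρm k hmk le_rfl
          · exact hρm j h1 h3
        · rw [hst', aggTime_succ]
          simp only
          rw [hsm]; ring
        · rw [hst']
          exact not_le.mp hreset'
  obtain ⟨C, hC⟩ := ((Finset.range m₀).image fun n => ‖x n‖).bddAbove
  refine ⟨max C (B * max R ‖x m₀‖), fun n => ?_⟩
  rcases Nat.lt_or_ge n m₀ with hn | hn
  · exact (hC (by simpa using ⟨n, hn, rfl⟩)).trans (le_max_left _ _)
  · obtain ⟨m, hKm, hmk, hρm, hsm, hsT, hle⟩ := inv n hn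
    have hw := (window m hKm n hmk (by linarith) (fun j h1 h2 => hρm j h1 h2.le)).2
    refine (hw.trans ?_).trans (le_max_right _ _)
    gcongr

end Stability
end AsyncSA
end

noncomputable section

namespace AsyncSA

/-! ### Limit sets of asymptotic pseudotrajectories -/

section LimitSet

variable {d : ℕ} {f : (Fin d → ℝ) → (Fin d → ℝ)}

/-- The set of limit points of `X t` as `t → ∞`. -/
def limitSet (X : ℝ → Fin d → ℝ) : Set (Fin d → ℝ) := {p | MapClusterPt p atTop X}

/-- `X` follows the flow of `f` asymptotically, uniformly over bounded time intervals. -/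
def IsAsymptoticPseudotrajectory (f : (Fin d → ℝ) → (Fin d → ℝ)) (hf : ∃ L, LipschitzWith L f)
    (X : ℝ → Fin d → ℝ) : Prop :=
  ∀ T : ℝ, ∀ ε > 0, ∀ᶠ t in atTop, ∀ s ∈ Icc 0 T, ‖X (t + s) - flow f hf (X t) s‖ ≤ ε

lemma mem_limitSet_iff {X : ℝ → Fin d → ℝ} {p : Fin d → ℝ} :
    p ∈ limitSet X ↔ ∀ ε > 0, ∃ᶠ t in atTop, ‖X t - p‖ < ε := by
  simp only [limitSet, mem_ofPred_eq, mapClusterPt_iff_frequently]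
  rw [Metric.nhds_basis_ball.forall_iff fun s t hst h => h.mono fun a ha => hst ha]
  simp [dist_eq_norm]

variable {X : ℝ → Fin d → ℝ} {C : ℝ} (hC : ∀ t, ‖X t‖ ≤ C)

include hC in
-- Otherwise `X` is in the compact set `closedBall 0 C ∩ Uᶜ` at arbitrarily late times and has a
-- limit point there.
lemma eventually_mem_of_limitSet_subset {U : Set (Fin d → ℝ)} (hU : IsOpen U)
    (h : limitSet X ⊆ U) : ∀ᶠ t in atTop, X t ∈ U := by
  by_contra hcon
  have hfreq : ∃ᶠ t in atTop, X t ∈ Metric.closedBall 0 C ∩ Uᶜ := by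
    rw [not_eventually] at hcon
    exact hcon.mono fun t ht => ⟨mem_closedBall_zero_iff.mpr (hC t), ht⟩
  obtain ⟨p, hp, hp'⟩ := ((isCompact_closedBall _ _).inter_right
    hU.isClosed_compl).exists_mapClusterPt_of_frequently hfreq
  exact hp.2 (h hp')

include hC in
lemma isCompact_limitSet : IsCompact (limitSet X) := by
  refine (isCompact_closedBall (0 : Fin d → ℝ) C).of_isClosed_subset
    isClosed_setOfPred_clusterPt fun p hp => ?_
  have h1 := mapClusterPt_atTop_iff_forall_mem_closure.mp hp 0
  refine closure_minimal ?_ Metric.isClosed_closedBall h1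
  rintro _ ⟨t, _, rfl⟩
  exact mem_closedBall_zero_iff.mpr (hC t)

include hC in
lemma limitSet_nonempty : (limitSet X).Nonempty := by
  obtain ⟨p, _, hp⟩ := (isCompact_closedBall (0 : Fin d → ℝ) C).exists_mapClusterPt_of_frequently
    (l := atTop) (f := X)
    (Frequently.of_forall fun t => mem_closedBall_zero_iff.mpr (hC t))
  exact ⟨p, hp⟩

include hC in
lemma tendsto_infDist_limitSet :
    Tendsto (fun t => Metric.infDist (X t) (limitSet X)) atTop (𝓝 0) := by
  rw [Metric.tendsto_nhds]
  intro ε hε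
  have h := eventually_mem_of_limitSet_subset hC (U := {p | Metric.infDist p (limitSet X) < ε})
    (isOpen_lt (Metric.continuous_infDist_pt _) continuous_const)
    (fun p hp => by simpa [Metric.infDist_zero_of_mem hp] using hε)
  filter_upwards [h] with t ht
  rw [Real.dist_eq, sub_zero, abs_of_nonneg Metric.infDist_nonneg]
  exact ht

include hC in
-- If the limit set split into two separated compact pieces, a tail of `X` would lie in two disjoint
-- open sets and visit both, although the image of `[t₀, ∞)` is connected.
lemma isConnected_limitSet (hX : Continuous X) : IsConnected (limitSet X) := by
  refine ⟨limitSet_nonempty hC, ?_⟩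
  rw [isPreconnected_closed_iff]
  intro A B hA hB hAB hnA hnB
  by_contra hcon
  have hK := isCompact_limitSet hC
  have hdisj : Disjoint (limitSet X ∩ A) (limitSet X ∩ B) := by
    rw [Set.disjoint_left]
    intro p h1 h2
    exact hcon ⟨p, h1.1, h1.2, h2.2⟩
  obtain ⟨U, V, hU, hV, hAU, hBV, hUV⟩ :=
    SeparatedNhds.of_isCompact_isCompact (hK.inter_right hA) (hK.inter_right hB) hdisj
  have hev : ∀ᶠ t in atTop, X t ∈ U ∪ V :=
    eventually_mem_of_limitSet_subset hC (hU.union hV) fun p hp => by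
      rcases hAB hp with h | h
      · exact Or.inl (hAU ⟨hp, h⟩)
      · exact Or.inr (hBV ⟨hp, h⟩)
  obtain ⟨t₀, ht₀⟩ := eventually_atTop.mp hev
  have hvisit : ∀ {W A : Set (Fin d → ℝ)}, IsOpen W → limitSet X ∩ A ⊆ W →
      (limitSet X ∩ A).Nonempty → (X '' Ici t₀ ∩ W).Nonempty := by
    rintro W A hW hAW ⟨p, hp⟩
    have h1 : ∃ᶠ t in atTop, X t ∈ W :=
      mapClusterPt_iff_frequently.mp hp.1 W (hW.mem_nhds (hAW hp))
    obtain ⟨t, ht, ht'⟩ := (h1.and_eventually (eventually_ge_atTop t₀)).exists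
    exact ⟨X t, ⟨t, ht', rfl⟩, ht⟩
  obtain ⟨q, _, hq⟩ := (isPreconnected_Ici.image X hX.continuousOn) U V hU hV
    (by rintro _ ⟨t, ht, rfl⟩; exact ht₀ t ht) (hvisit hU hAU hnA) (hvisit hV hBV hnB)
  exact Set.disjoint_left.mp hUV hq.1 hq.2

namespace IsAsymptoticPseudotrajectory

variable {hf : ∃ L, LipschitzWith L f} (hX : IsAsymptoticPseudotrajectory f hf X)

include hX in
/-- An asymptotic pseudotrajectory follows the flow backward in time, too. -/
lemma two_sided (T : ℝ) {ε : ℝ} (hε : 0 < ε) :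
    ∀ᶠ t in atTop, ∀ s ∈ Icc (-T) T, ‖X (t + s) - flow f hf (X t) s‖ ≤ ε := by
  obtain ⟨L, hL⟩ := id hf
  set e : ℝ := Real.exp (L * |T|) with he
  have he0 : 0 < e := Real.exp_pos _
  obtain ⟨t₀, ht₀⟩ := eventually_atTop.mp (hX T (ε / e) (by positivity))
  filter_upwards [hX T ε hε, eventually_ge_atTop (t₀ + |T|)] with t h1 h2 s hs
  rcases le_total 0 s with h0 | h0
  · exact h1 s ⟨h0, hs.2⟩
  · have hT : |s| ≤ |T| := by
      rw [abs_of_nonpos h0]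
      linarith [hs.1, le_abs_self T]
    -- For `s < 0`, track forward from the earlier time `t + s` to `t`, then flow back by `s`, which
    -- expands errors by at most `e`.
    have h3 := ht₀ (t + s) (by linarith [neg_abs_le s]) (-s) ⟨by linarith, by linarith [hs.1]⟩
    rw [add_neg_cancel_right] at h3
    have h4 := norm_flow_sub_flow_le hf hL (X t) (flow f hf (X (t + s)) (-s)) s
    rw [← flow_add, neg_add_cancel, flow_zero] at h4
    rw [norm_sub_rev]
    refine h4.trans ?_
    calc _ ≤ ε / e * e := by
          refine mul_le_mul h3 ?_ (by positivity) (by positivity)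
          exact Real.exp_le_exp.mpr (mul_le_mul_of_nonneg_left hT L.coe_nonneg)
      _ = ε := by field_simp

include hX in
lemma tendsto_sub_flow (s : ℝ) :
    Tendsto (fun t => X (t + s) - flow f hf (X t) s) atTop (𝓝 0) := by
  rw [Metric.tendsto_nhds]
  intro ε hε
  filter_upwards [hX.two_sided |s| (half_pos hε)] with t ht
  rw [dist_zero_right]
  linarith [ht s (abs_le.mp le_rfl)]

include hX in
-- The time-`s` map is continuous and carries limit points of `X t` to limit points of `flow f hf (X
-- t) s`, which differs from `X (t + s)` by a vanishing amount. Two-sided tracking allows negative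
-- `s`.
lemma flow_mem_limitSet {p : Fin d → ℝ} (hp : p ∈ limitSet X) (s : ℝ) :
    flow f hf p s ∈ limitSet X := by
  have h1 : MapClusterPt (flow f hf p s) atTop fun t => flow f hf (X t) s :=
    MapClusterPt.continuousAt_comp (continuous_flow_left hf s).continuousAt hp
  rw [mem_limitSet_iff]
  intro ε hε
  have h2 := mapClusterPt_iff_frequently.mp h1 _ (Metric.ball_mem_nhds _ (half_pos hε))
  have h3 := (hX.tendsto_sub_flow s).eventually (Metric.ball_mem_nhds _ (half_pos hε))
  have h4 : ∃ᶠ t in atTop, ‖X (t + s) - flow f hf p s‖ < ε := by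
    refine (h2.and_eventually h3).mono fun t ht => ?_
    have h5 := ht.1
    have h6 := ht.2
    rw [Metric.mem_ball, dist_eq_norm] at h5
    rw [dist_zero_right] at h6
    have := norm_sub_le_norm_sub_add_norm_sub (X (t + s)) (flow f hf (X t) s) (flow f hf p s)
    linarith
  exact (tendsto_atTop_add_const_right atTop s tendsto_id).frequently h4

include hX hC in
-- A piece of trajectory from a late visit near `a` to a later visit near `b` is cut at equal time
-- steps, and the cut points are moved to nearby points of the limit set. Moving the start of a
-- step, tracking the flow and moving its end cost at most `ε / 4` each.
lemma exists_chain {a b : Fin d → ℝ} (ha : a ∈ limitSet X) (hb : b ∈ limitSet X)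
    {ε T : ℝ} (hε : 0 < ε) (hT : 0 < T) :
    ∃ n ≥ 1, ∃ p : ℕ → Fin d → ℝ, p 0 = a ∧ p n = b ∧ (∀ i ≤ n, p i ∈ limitSet X) ∧
      ∀ i < n, ∃ t ≥ T, ‖flow f hf (p i) t - p (i + 1)‖ < ε := by
  obtain ⟨L, hL⟩ := id hf
  set e : ℝ := Real.exp (L * (2 * T)) with he
  have he1 : 1 ≤ e := Real.one_le_exp (by positivity)
  have he0 : 0 < e := by linarith
  set δ : ℝ := ε / (4 * e) with hδ
  have hδ0 : 0 < δ := by positivity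
  have hδe : δ * e = ε / 4 := by rw [hδ]; field_simp
  have hδε : δ ≤ ε / 4 := by nlinarith
  obtain ⟨t₀, ht₀⟩ := eventually_atTop.mp ((hX (2 * T) (ε / 4) (by positivity)).and
    ((tendsto_infDist_limitSet hC).eventually_lt_const hδ0))
  obtain ⟨t₁, hat, ht₁⟩ := ((mem_limitSet_iff.mp ha δ hδ0).and_eventually
    (eventually_ge_atTop t₀)).exists
  obtain ⟨t₂, hbt, ht₂⟩ := ((mem_limitSet_iff.mp hb δ hδ0).and_eventually
    (eventually_ge_atTop (t₁ + T))).exists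
  have hq1 : 1 ≤ (t₂ - t₁) / T := (one_le_div hT).mpr (by linarith)
  -- Rounding down makes the step `τ` at least `T`, and at most `2 * T`, the horizon over which
  -- tracking is known.
  set n : ℕ := ⌊(t₂ - t₁) / T⌋₊ with hn
  have hn1 : 1 ≤ n := Nat.one_le_floor_iff _ |>.mpr hq1
  have hnR : (1 : ℝ) ≤ n := by exact_mod_cast hn1
  have hn0 : (0 : ℝ) < n := by linarith
  set τ : ℝ := (t₂ - t₁) / n with hτ
  have hτT : T ≤ τ := by
    rw [hτ, le_div_iff₀ hn0]
    have := Nat.floor_le (show 0 ≤ (t₂ - t₁) / T by linarith)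
    rw [← hn, le_div_iff₀ hT] at this
    linarith
  have hτ2T : τ ≤ 2 * T := by
    rw [hτ, div_le_iff₀ hn0]
    have := Nat.lt_floor_add_one ((t₂ - t₁) / T)
    rw [← hn, div_lt_iff₀ hT] at this
    nlinarith
  have hτ0 : 0 < τ := by linarith
  set q : ℕ → ℝ := fun i => t₁ + i * τ with hq
  have hq0 : ∀ i, t₀ ≤ q i := fun i => by
    have : 0 ≤ i * τ := by positivity
    simp only [hq]; linarith
  have hqn : q n = t₂ := by simp only [hq, hτ]; field_simp; ring
  have hnear : ∀ i, ∃ p ∈ limitSet X, dist (X (q i)) p < δ := fun i =>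
    (Metric.infDist_lt_iff (limitSet_nonempty hC)).mp (ht₀ (q i) (hq0 i)).2
  choose p' hp'D hp' using hnear
  set p : ℕ → Fin d → ℝ := fun i => if i = 0 then a else if i = n then b else p' i with hp
  have hpD : ∀ i, p i ∈ limitSet X := by
    intro i
    simp only [hp]
    split_ifs
    exacts [ha, hb, hp'D i]
  have hpn : ∀ i, ‖X (q i) - p i‖ < δ := by
    intro i
    simp only [hp]
    split_ifs with h1 h2
    · rw [h1]; simpa [hq] using hat
    · rw [h2, hqn]; exact hbt
    · rw [← dist_eq_norm]; exact hp' i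
  refine ⟨n, hn1, p, by simp [hp], ?_, fun i _ => hpD i, fun i hi => ⟨τ, hτT, ?_⟩⟩
  · simp only [hp]
    rw [if_neg (by omega), if_pos trivial]
  · have h1 := (ht₀ (q i) (hq0 i)).1 τ ⟨hτ0.le, hτ2T⟩
    have h2 : q i + τ = q (i + 1) := by simp only [hq]; push_cast; ring
    rw [h2] at h1
    have h3 := norm_flow_sub_flow_le hf hL (p i) (X (q i)) τ
    have h4 : ‖p i - X (q i)‖ * Real.exp (L * |τ|) ≤ ε / 4 := by
      rw [← hδe]
      refine mul_le_mul ?_ ?_ (by positivity) hδ0.le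
      · rw [norm_sub_rev]; exact (hpn i).le
      · rw [abs_of_pos hτ0]
        exact Real.exp_le_exp.mpr (mul_le_mul_of_nonneg_left hτ2T L.coe_nonneg)
    have h5 := hpn (i + 1)
    have h6 := norm_sub_le_norm_sub_add_norm_sub (flow f hf (p i) τ) (flow f hf (X (q i)) τ)
      (p (i + 1))
    have h7 := norm_sub_le_norm_sub_add_norm_sub (flow f hf (X (q i)) τ) (X (q (i + 1)))
      (p (i + 1))
    rw [norm_sub_rev] at h1
    linarith

/-- The limit points of the shifts of an asymptotic pseudotrajectory are solutions. -/
lemma eq_flow_of_mapClusterPt_shift {X : C(ℝ, Fin d → ℝ)}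
    (hX : IsAsymptoticPseudotrajectory f hf X) {z : C(ℝ, Fin d → ℝ)}
    (hz : MapClusterPt z atTop (shift X)) (s : ℝ) : z s = flow f hf (z 0) s := by
  have hcont : Continuous fun g : C(ℝ, Fin d → ℝ) => g s - flow f hf (g 0) s :=
    (continuous_eval_const s).sub
      ((continuous_flow_left hf s).comp (continuous_eval_const (0 : ℝ)))
  have h1 : MapClusterPt (z s - flow f hf (z 0) s) atTop
      fun t => X (t + s) - flow f hf (X t) s := by
    have := MapClusterPt.continuousAt_comp hcont.continuousAt hz
    simpa [shift, Function.comp_def] using this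
  have h2 : ClusterPt (z s - flow f hf (z 0) s) (𝓝 (0 : Fin d → ℝ)) :=
    ClusterPt.mono h1 (hX.tendsto_sub_flow s)
  have h3 : z s - flow f hf (z 0) s = 0 := eq_of_nhds_neBot h2
  exact sub_eq_zero.mp h3

lemma mem_limitSet_of_mapClusterPt_shift {X z : C(ℝ, Fin d → ℝ)}
    (hz : MapClusterPt z atTop (shift X)) (s : ℝ) : z s ∈ limitSet X := by
  have h1 : MapClusterPt (z s) atTop fun t => X (t + s) :=
    MapClusterPt.continuousAt_comp (f := fun g : C(ℝ, Fin d → ℝ) => g s)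
      (continuous_eval_const s).continuousAt hz
  exact MapClusterPt.of_comp (φ := fun t => t + s)
    (tendsto_atTop_add_const_right atTop s tendsto_id) h1

include hX hC in
-- At late times `X` stays close to orbits of speed at most `V`; up to then it is continuous on a
-- compact interval, and before that constant. The unit margins at both ends place two nearby times
-- in a common region.
lemma uniformContinuous (hcont : Continuous X) (hconst : ∀ t ≤ 0, X t = X 0) :
    UniformContinuous X := by
  obtain ⟨L, hL⟩ := id hf
  obtain ⟨B, hB, hB'⟩ := exists_norm_flow_le hf C 1
  set V : ℝ := L * B + ‖f 0‖ with hV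
  have hV0 : 0 ≤ V := by positivity
  have hspeed : ∀ p : Fin d → ℝ, ‖p‖ ≤ C → ∀ s ∈ Icc (0 : ℝ) 1, ‖flow f hf p s - p‖ ≤ V * s := by
    intro p hp s hs
    have := norm_flow_sub_flow_time_le hf (p := p) (C := V) (a := 0) (b := 1) (s := 0) (t := s)
      (fun u hu => (norm_le_of_lipschitzWith hL _).trans (by
        have := hB' p hp u (abs_le.mpr ⟨by linarith [hu.1], hu.2⟩)
        rw [hV]
        gcongr)) ⟨le_rfl, zero_le_one⟩ hs
    simpa [abs_of_nonneg hs.1] using this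
  rw [Metric.uniformContinuous_iff]
  intro ε hε
  obtain ⟨t₀, ht₀⟩ := eventually_atTop.mp (hX 1 (ε / 4) (by positivity))
  have huc := (isCompact_Icc (a := (-1 : ℝ)) (b := t₀ + 1)).uniformContinuousOn_of_continuous
    hcont.continuousOn
  obtain ⟨δ, hδ, hδ'⟩ := Metric.uniformContinuousOn_iff.mp huc ε hε
  have key : ∀ s t : ℝ, s ≤ t → t - s < min δ (min 1 (ε / (4 * (V + 1)))) → ‖X t - X s‖ < ε := by
    intro s t hst hlt
    obtain ⟨h1, h2, h3⟩ : t - s < δ ∧ t - s < 1 ∧ t - s < ε / (4 * (V + 1)) := by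
      simpa [lt_min_iff] using hlt
    rcases le_or_gt t₀ s with h0 | h0
    · have e1 := ht₀ s h0 (t - s) ⟨by linarith, h2.le⟩
      have e2 := hspeed (X s) (hC s) (t - s) ⟨by linarith, h2.le⟩
      rw [add_sub_cancel] at e1
      have e3 : V * (t - s) ≤ ε / 4 := by
        rw [lt_div_iff₀ (by positivity)] at h3
        nlinarith
      have := norm_sub_le_norm_sub_add_norm_sub (X t) (flow f hf (X s) (t - s)) (X s)
      linarith
    · rcases le_or_gt (-1) s with h4 | h4
      · rw [← dist_eq_norm]
        refine hδ' t ⟨by linarith, by linarith⟩ s ⟨h4, by linarith⟩ ?_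
        rwa [Real.dist_eq, abs_of_nonneg (by linarith)]
      · rw [hconst t (by linarith), hconst s (by linarith)]
        simpa using hε
  refine ⟨min δ (min 1 (ε / (4 * (V + 1)))), by positivity, fun {s t} hst => ?_⟩
  rw [Real.dist_eq] at hst
  rcases le_total s t with h | h
  · rw [dist_comm, dist_eq_norm]
    exact key s t h (by rwa [abs_sub_comm, abs_of_nonneg (by linarith)] at hst)
  · rw [dist_eq_norm]
    exact key t s h (by rwa [abs_of_nonneg (by linarith)] at hst)

end IsAsymptoticPseudotrajectory

/-- A bounded uniformly continuous trajectory has a relatively compact family of shifts. -/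
lemma isCompact_closure_range_shift {X : C(ℝ, Fin d → ℝ)} {C : ℝ} (hC : ∀ t, ‖X t‖ ≤ C)
    (hX : UniformContinuous X) : IsCompact (closure (range (shift X))) := by
  have hu : ∀ ε : ℝ, ∃ δ > 0, 0 < ε → ∀ s t : ℝ, |s - t| < δ → ‖X s - X t‖ < ε := by
    intro ε
    by_cases hε : 0 < ε
    · obtain ⟨δ, hδ, h⟩ := Metric.uniformContinuous_iff.mp hX ε hε
      exact ⟨δ, hδ, fun _ s t hst => by simpa [dist_eq_norm] using h (a := s) (b := t) hst⟩
    · exact ⟨1, one_pos, fun h => absurd h hε⟩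
  choose δ hδ hmod using hu
  -- All shifts share the bound and the modulus of continuity `δ` of `X`. With non-strict
  -- inequalities these conditions are closed under pointwise limits, so Tychonoff gives pointwise
  -- compactness, and equicontinuity upgrades it.
  set P : (ℝ → Fin d → ℝ) → Prop := fun g => (∀ t, ‖g t‖ ≤ C) ∧
    ∀ ε > 0, ∀ s t : ℝ, |s - t| < δ ε → ‖g s - g t‖ ≤ ε with hP
  set S : Set C(ℝ, Fin d → ℝ) := {g | P g} with hS
  have hcont : ∀ g, P g → Continuous g := by
    intro g hg
    rw [Metric.continuous_iff]
    intro t ε hε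
    refine ⟨δ (ε / 2), hδ _, fun s hs => ?_⟩
    rw [dist_eq_norm]
    have := hg.2 (ε / 2) (half_pos hε) s t (by rwa [Real.dist_eq] at hs)
    linarith
  have himg : ContinuousMap.toFun '' S = {g | P g} := by
    ext g
    constructor
    · rintro ⟨g, hg, rfl⟩; exact hg
    · intro hg; exact ⟨⟨g, hcont g hg⟩, hg, rfl⟩
  have hcomp : IsCompact (ContinuousMap.toFun '' S) := by
    rw [himg]
    refine (isCompact_univ_pi fun _ : ℝ =>
      isCompact_closedBall (0 : Fin d → ℝ) C).of_isClosed_subset ?_ ?_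
    · have : {g | P g} = (⋂ t, {g : ℝ → Fin d → ℝ | ‖g t‖ ≤ C}) ∩
          ⋂ ε, ⋂ (_ : ε > 0), ⋂ s, ⋂ t, ⋂ (_ : |s - t| < δ ε),
            {g : ℝ → Fin d → ℝ | ‖g s - g t‖ ≤ ε} := by
        ext g; simp [hP]
      rw [this]
      refine (isClosed_iInter fun t => isClosed_le (by fun_prop) continuous_const).inter ?_
      exact isClosed_iInter fun ε => isClosed_iInter fun _ => isClosed_iInter fun s =>
        isClosed_iInter fun t => isClosed_iInter fun _ =>
          isClosed_le (by fun_prop) continuous_const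
    · intro g hg t _
      exact mem_closedBall_zero_iff.mpr (hg.1 t)
  have hequi : Equicontinuous ((↑) : S → ℝ → Fin d → ℝ) := by
    intro t
    rw [Metric.equicontinuousAt_iff]
    intro ε hε
    refine ⟨δ (ε / 2), hδ _, fun s hs g => ?_⟩
    rw [dist_comm, dist_eq_norm]
    have := g.2.2 (ε / 2) (half_pos hε) s t (by rwa [Real.dist_eq] at hs)
    change ‖(g : C(ℝ, Fin d → ℝ)) s - (g : C(ℝ, Fin d → ℝ)) t‖ < ε
    linarith
  refine (ArzelaAscoli.isCompact_of_equicontinuous S hcomp hequi).closure_of_subset ?_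
  rintro _ ⟨t, rfl⟩
  refine ⟨fun s => hC _, fun ε hε s s' hs => (hmod ε hε (t + s) (t + s') ?_).le⟩
  simpa using hs

end LimitSet
end AsyncSA
end

noncomputable section

namespace AsyncSA

/-! ### The interpolated trajectory -/

section Interpolation

variable {d : ℕ} {α : ℕ → ℝ} {Y : ℕ → Finset (Fin d)} {x : ℕ → Fin d → ℝ}

lemma segmentIndex_spec (ht : Tendsto (aggTime α Y) atTop atTop) {s : ℝ} (hs : 0 ≤ s) :
    aggTime α Y (segmentIndex α Y s) ≤ s ∧ s < aggTime α Y (segmentIndex α Y s + 1) := by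
  have hne : {n : ℕ | s < aggTime α Y (n + 1)}.Nonempty :=
    ((ht.comp (tendsto_add_atTop_nat 1)).eventually_gt_atTop s).exists
  refine ⟨?_, Nat.sInf_mem hne⟩
  rcases Nat.eq_zero_or_pos (segmentIndex α Y s) with h | h
  · rw [h]; simpa [aggTime] using hs
  · have := Nat.notMem_of_lt_sInf (m := segmentIndex α Y s - 1)
      (s := {n : ℕ | s < aggTime α Y (n + 1)})
      (by change _ < segmentIndex α Y s; omega)
    rw [mem_ofPred_eq, not_lt, Nat.sub_add_cancel h] at this
    exact this

variable (hα : ∀ n, 0 < α n) (hY : ∀ n, (Y n).Nonempty)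
  (ht : Tendsto (aggTime α Y) atTop atTop)

include hα hY in
lemma aggTime_nonneg (n : ℕ) : 0 ≤ aggTime α Y n := by
  have := (aggTime_strictMono hα hY).monotone (Nat.zero_le n)
  simpa [aggTime] using this

include hα hY ht in
lemma segmentIndex_eq {s : ℝ} {n : ℕ} (h1 : aggTime α Y n ≤ s) (h2 : s < aggTime α Y (n + 1)) :
    segmentIndex α Y s = n := by
  have hmono := aggTime_strictMono hα hY
  obtain ⟨h3, h4⟩ := segmentIndex_spec ht ((aggTime_nonneg hα hY n).trans h1)
  have h5 := hmono.lt_iff_lt.mp (h3.trans_lt h2)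
  have h6 := hmono.lt_iff_lt.mp (h1.trans_lt h4)
  omega

include hα hY ht in
-- At the right endpoint `segmentIndex` is already `n + 1`, but both formulas give `x (n + 1)`
-- there; on closed segments the pieces can be glued.
lemma interp_of_mem {s : ℝ} {n : ℕ} (hs : s ∈ Icc (aggTime α Y n) (aggTime α Y (n + 1))) :
    interp α Y x s = x n +
      ((s - aggTime α Y n) / (aggTime α Y (n + 1) - aggTime α Y n)) • (x (n + 1) - x n) := by
  have hmono := aggTime_strictMono hα hY
  have hs0 : ¬ s < 0 := not_lt.mpr ((aggTime_nonneg hα hY n).trans hs.1)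
  simp only [interp, if_neg hs0]
  rcases hs.2.lt_or_eq with h | h
  · rw [segmentIndex_eq hα hY ht hs.1 h]
  · rw [segmentIndex_eq hα hY ht (n := n + 1) h.ge (h ▸ hmono (Nat.lt_succ_self _)), h, sub_self,
      zero_div, zero_smul, div_self (sub_pos.mpr (hmono n.lt_succ_self)).ne']
    simp

include hα hY ht in
lemma interp_of_nonpos {s : ℝ} (hs : s ≤ 0) : interp α Y x s = x 0 := by
  rcases hs.lt_or_eq with h | h
  · simp [interp, h]
  · have h0 : aggTime α Y 0 = 0 := by simp [aggTime]
    rw [interp_of_mem hα hY ht (n := 0)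
      ⟨by rw [h, h0], by rw [h]; exact aggTime_nonneg hα hY 1⟩, h, h0]
    simp

include hα hY ht in
lemma interp_aggTime (n : ℕ) : interp α Y x (aggTime α Y n) = x n := by
  rw [interp_of_mem hα hY ht ⟨le_rfl, (aggTime_strictMono hα hY n.lt_succ_self).le⟩]
  simp

include hα hY ht in
lemma continuous_interp : Continuous (interp α Y x) := by
  have hmono := aggTime_strictMono hα hY
  have hon : ∀ n, ContinuousOn (interp α Y x) (Iic (aggTime α Y n)) := by
    intro n
    induction n with
    | zero =>
      refine (continuousOn_const (c := x 0)).congr fun s hs => ?_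
      exact interp_of_nonpos hα hY ht (by simpa [aggTime] using hs)
    | succ n ih =>
      rw [← Iic_union_Icc_eq_Iic (hmono n.lt_succ_self).le]
      refine ih.union_of_isClosed ?_ isClosed_Iic isClosed_Icc
      refine ContinuousOn.congr (f := fun s => x n +
        ((s - aggTime α Y n) / (aggTime α Y (n + 1) - aggTime α Y n)) • (x (n + 1) - x n)) ?_
        fun s hs => interp_of_mem hα hY ht hs
      fun_prop
  rw [continuous_iff_continuousAt]
  intro s
  obtain ⟨n, hn⟩ := (ht.eventually_gt_atTop s).exists
  exact (hon n).continuousAt (Iic_mem_nhds hn)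

include hα hY in
lemma segment_ratio_mem {s : ℝ} {n : ℕ} (hs : s ∈ Icc (aggTime α Y n) (aggTime α Y (n + 1))) :
    (s - aggTime α Y n) / (aggTime α Y (n + 1) - aggTime α Y n) ∈ Icc (0 : ℝ) 1 := by
  have hpos := sub_pos.mpr (aggTime_strictMono hα hY n.lt_succ_self)
  exact ⟨div_nonneg (by linarith [hs.1]) hpos.le, (div_le_one hpos).mpr (by linarith [hs.2])⟩

include hα hY ht in
lemma norm_interp_sub_le {s : ℝ} {n : ℕ}
    (hs : s ∈ Icc (aggTime α Y n) (aggTime α Y (n + 1))) :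
    ‖interp α Y x s - x n‖ ≤ ‖x (n + 1) - x n‖ := by
  have := segment_ratio_mem hα hY hs
  rw [interp_of_mem hα hY ht hs, add_sub_cancel_left, norm_smul, Real.norm_of_nonneg this.1]
  exact mul_le_of_le_one_left (norm_nonneg _) this.2

include hα hY ht in
lemma norm_interp_le {C : ℝ} (hC : ∀ n, ‖x n‖ ≤ C) (s : ℝ) : ‖interp α Y x s‖ ≤ C := by
  rcases le_total s 0 with h | h
  · rw [interp_of_nonpos hα hY ht h]; exact hC 0
  · obtain ⟨h1, h2⟩ := segmentIndex_spec ht h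
    have hmem := segment_ratio_mem hα hY ⟨h1, h2.le⟩
    rw [interp_of_mem hα hY ht ⟨h1, h2.le⟩]
    exact mem_closedBall_zero_iff.mp ((convex_closedBall (0 : Fin d → ℝ) C).add_smul_sub_mem
      (mem_closedBall_zero_iff.mpr (hC _)) (mem_closedBall_zero_iff.mpr (hC _)) hmem)

end Interpolation

/-! ### Convergence along a sample path -/

section Path

variable {d : ℕ} {h : (Fin d → ℝ) → (Fin d → ℝ)} {α : ℕ → ℝ} {Y : ℕ → Finset (Fin d)}
  {x M ε : ℕ → Fin d → ℝ} {δ : ℕ → ℝ} {C : ℝ}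

/-- Bounded iterates follow the flow of `h / d` over bounded stretches of the aggregated clock. -/
lemma eventually_norm_sub_flow_le (hd : 0 < d) (hh : ∃ L, LipschitzWith L h)
    (hf : ∃ L, LipschitzWith L fun y => (1 / (d : ℝ)) • h y)
    (hα : StepsizeConditions α) (hY : RegularUpdates α Y)
    (hx : ∀ n i, x (n + 1) i = x n i +
      compStep α Y n i * (h (x n) i + M (n + 1) i + ε (n + 1) i))
    (hδ : Tendsto δ atTop (𝓝 0)) (hε : ∀ n, ‖ε (n + 1)‖ ≤ δ (n + 1) * (1 + ‖x n‖))
    (hnoise : ∀ i, ∃ l, Tendsto (fun n => ∑ k ∈ Finset.range n,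
      compStep α Y k i * M (k + 1) i) atTop (𝓝 l))
    (hC : ∀ n, ‖x n‖ ≤ C) {T η : ℝ} (hT : 0 < T) (hη : 0 < η) :
    ∀ᶠ m in atTop, ∀ k ≥ m, aggTime α Y k - aggTime α Y m ≤ T →
      ‖x k - flow (fun y => (1 / (d : ℝ)) • h y) hf (x m)
        (aggTime α Y k - aggTime α Y m)‖ ≤ η := by
  obtain ⟨L, hL⟩ := hh
  have hdR : (0 : ℝ) < d := by exact_mod_cast hd
  have hd1 : (1 : ℝ) ≤ d := by exact_mod_cast hd
  have hC0 : 0 ≤ C := (norm_nonneg _).trans (hC 0)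
  set c : ℝ := 1 / d with hc
  have hc0 : 0 < c := by positivity
  have hc1 : c ≤ 1 := by rw [hc, div_le_one hdR]; exact hd1
  obtain ⟨B, hB, hB'⟩ := exists_norm_flow_le hf C T
  set V : ℝ := L * B + ‖h 0‖ with hV
  have hV0 : 0 ≤ V := by positivity
  set e : ℝ := Real.exp (L * T) with he
  have he0 : 0 < e := Real.exp_pos _
  set κ : ℝ := η / (e * (1 + (V + L * V * T) + L * V * T)) with hκ
  have hκ0 : 0 < κ := by positivity
  have hκsum : (κ + T * 0 + κ * (V + L * V * T) + L * V * κ * T) * e = η := by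
    have : (κ + T * 0 + κ * (V + L * V * T) + L * V * κ * T) * e =
        κ * (e * (1 + (V + L * V * T) + L * V * T)) := by ring
    rw [this, hκ, div_mul_cancel₀ _ (by positivity)]
  set ζ : ℕ → Fin d → ℝ := fun n i => ∑ k ∈ Finset.range n,
    compStep α Y k i * M (k + 1) i with hζ
  set ρ : ℝ := κ / (2 * ((1 + C) * T)) with hρ
  have hcauchy : ∀ i, ∀ᶠ m in atTop, ∀ k ≥ m, |ζ k i - ζ m i| ≤ κ / 2 := by
    intro i
    obtain ⟨l, hl⟩ := hnoise i
    obtain ⟨K, hK⟩ := Metric.cauchySeq_iff.mp hl.cauchySeq (κ / 2) (by positivity)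
    filter_upwards [eventually_ge_atTop K] with m hm k hk
    have := hK k (by omega) m hm
    rw [Real.dist_eq] at this
    exact this.le
  have hδ' : ∀ᶠ m in atTop, ∀ k ≥ m, δ (k + 1) ≤ ρ := by
    obtain ⟨K, hK⟩ := eventually_atTop.mp (hδ.eventually_le_const (show 0 < ρ by positivity))
    filter_upwards [eventually_ge_atTop K] with m hm k hk
    exact hK _ (by omega)
  have hagg : ∀ᶠ m in atTop, ∀ k ≥ m, aggStep α Y k ≤ κ := by
    obtain ⟨K, hK⟩ := eventually_atTop.mp
      ((hα.tendsto_aggStep (Y := Y)).eventually_le_const hκ0)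
    filter_upwards [eventually_ge_atTop K] with m hm k hk
    exact hK _ (by omega)
  have hmono := (aggTime_strictMono hα.pos hY.nonempty).monotone
  filter_upwards [eventually_all.mpr hcauchy, hδ', hagg, hY.eventually_compTime_sub hα T hκ0]
    with m hK1 hK2 hK3 hK4 n hn hnT
  have htrack := norm_sub_solution_le (F := h) (G := h) (c := c)
    (V := V) (T := T) (η := 0) (β := κ) (ϑ := κ) (a := κ)
    (φ := flow (fun y => c • h y) hf (x m)) (y := x)
    (r := fun k i => compStep α Y k i * (M (k + 1) i + ε (k + 1) i))
    (m := m) (n := n) hα.pos hL hL hc0.le hc1 (isIntegralCurve_flow hf (x m)) hn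
    (by
      intro k _ _ i
      rw [hx]
      ring)
    (by
      intro k hmk hkn i
      have e1 : ∑ j ∈ Finset.Ico m k, compStep α Y j i * (M (j + 1) i + ε (j + 1) i) =
          (ζ k i - ζ m i) + ∑ j ∈ Finset.Ico m k, compStep α Y j i * ε (j + 1) i := by
        rw [hζ]
        simp only
        rw [← Finset.sum_Ico_eq_sub _ hmk, ← Finset.sum_add_distrib]
        exact Finset.sum_congr rfl fun j _ => by ring
      have e2 : |∑ j ∈ Finset.Ico m k, compStep α Y j i * ε (j + 1) i| ≤ κ / 2 := by
        calc _ ≤ ∑ j ∈ Finset.Ico m k, aggStep α Y j * (ρ * (1 + C)) := by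
              refine (Finset.abs_sum_le_sum_abs _ _).trans (Finset.sum_le_sum fun j hj => ?_)
              rw [Finset.mem_Ico] at hj
              rw [abs_mul, abs_of_nonneg (compStep_nonneg hα.pos j i)]
              refine mul_le_mul (compStep_le_aggStep hα.pos j i) ?_ (abs_nonneg _)
                (aggStep_pos hα.pos hY.nonempty j).le
              have h1 : |ε (j + 1) i| ≤ ‖ε (j + 1)‖ := norm_le_pi_norm (ε (j + 1)) i
              refine (h1.trans (hε j)).trans ?_
              have h2 := hK2 j hj.1
              have h3 := hC j
              gcongr
          _ = (aggTime α Y k - aggTime α Y m) * (ρ * (1 + C)) := by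
              rw [← Finset.sum_mul, sum_Ico_aggStep hmk]
          _ ≤ T * (ρ * (1 + C)) := by
              gcongr
              linarith [hmono hkn]
          _ = κ / 2 := by
              have : 1 + C ≠ 0 := by positivity
              rw [hρ]; field_simp
      rw [e1]
      refine (abs_add_le _ _).trans ?_
      linarith [hK1 i k hmk])
    hnT
    (fun s hs => (norm_le_of_lipschitzWith hL _).trans (by
      have := hB' (x m) (hC m) s (abs_le.mpr ⟨by linarith [hs.1], hs.2⟩)
      rw [hV]
      gcongr))
    (fun s _ => by simp)
    (fun k hmk hkn i => by
      have := hK4 k hmk (by linarith [hmono hkn]) i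
      rwa [div_eq_mul_one_div, mul_comm _ (1 / (d : ℝ))] at this)
    (fun k hmk _ => hK3 k hmk) (by simp) hκ0.le hκ0.le hκ0.le
  exact htrack.trans hκsum.le

/-- The interpolation of bounded iterates is an asymptotic pseudotrajectory of the flow of
`h / d`. -/
theorem isAsymptoticPseudotrajectory_interp (hd : 0 < d) (hh : ∃ L, LipschitzWith L h)
    (hf : ∃ L, LipschitzWith L fun y => (1 / (d : ℝ)) • h y)
    (hα : StepsizeConditions α) (hY : RegularUpdates α Y)
    (hx : ∀ n i, x (n + 1) i = x n i +
      compStep α Y n i * (h (x n) i + M (n + 1) i + ε (n + 1) i))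
    (hδ : Tendsto δ atTop (𝓝 0)) (hε : ∀ n, ‖ε (n + 1)‖ ≤ δ (n + 1) * (1 + ‖x n‖))
    (hnoise : ∀ i, ∃ l, Tendsto (fun n => ∑ k ∈ Finset.range n,
      compStep α Y k i * M (k + 1) i) atTop (𝓝 l))
    (hC : ∀ n, ‖x n‖ ≤ C) :
    IsAsymptoticPseudotrajectory (fun y => (1 / (d : ℝ)) • h y) hf (interp α Y x) := by
  intro T' θ hθ
  set f : (Fin d → ℝ) → (Fin d → ℝ) := fun y => (1 / (d : ℝ)) • h y with hfdef
  obtain ⟨L, hL⟩ := id hf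
  have ht := hY.tendsto_aggTime hα
  have hmono := aggTime_strictMono hα.pos hY.nonempty
  set T : ℝ := |T'| with hTdef
  have hT0 : 0 ≤ T := abs_nonneg _
  obtain ⟨B, hB, hB'⟩ := exists_norm_flow_le hf C (T + 1)
  set V : ℝ := L * B + ‖f 0‖ with hV
  have hV0 : 0 ≤ V := by positivity
  set e : ℝ := Real.exp (L * T) with he
  have he0 : 0 < e := Real.exp_pos _
  -- The final count is `2η` for the endpoint, `η` for tracking, `V η` for the time offset and `2η
  -- e` for the starting point, in total at most `2η (2 + V + e) = θ`.
  set η : ℝ := θ / (2 * (2 + V + e)) with hη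
  have hη0 : 0 < η := by positivity
  have hspeed : ∀ p : Fin d → ℝ, ‖p‖ ≤ C → ∀ s ∈ Icc 0 (T + 1), ∀ t ∈ Icc 0 (T + 1),
      ‖flow f hf p t - flow f hf p s‖ ≤ V * |t - s| := by
    intro p hp s hs t ht
    refine norm_flow_sub_flow_time_le hf (fun u hu => ?_) hs ht
    refine (norm_le_of_lipschitzWith hL _).trans ?_
    have := hB' p hp u (abs_le.mpr ⟨by linarith [hu.1], hu.2⟩)
    rw [hV]
    gcongr
  have htrack := eventually_norm_sub_flow_le hd hh hf hα hY hx hδ hε hnoise hC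
    (T := T + 1) (by positivity) hη0
  have hagg : ∀ᶠ k in atTop, aggStep α Y k ≤ min (η / (1 + V)) (min η 1) :=
    (hα.tendsto_aggStep (Y := Y)).eventually_le_const (by positivity)
  obtain ⟨K, hK⟩ := eventually_atTop.mp (htrack.and hagg)
  -- A single iteration is itself a short stretch of the clock: `x (k + 1)` is within `η` of the
  -- flow, which has moved by at most `η`.
  have hinc : ∀ k ≥ K, ‖x (k + 1) - x k‖ ≤ 2 * η := by
    intro k hk
    obtain ⟨h1, h2⟩ := hK k hk
    have hstep : aggTime α Y (k + 1) - aggTime α Y k = aggStep α Y k := by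
      rw [aggTime_succ]; ring
    have ha0 := (aggStep_pos hα.pos hY.nonempty k).le
    have ha1 : aggStep α Y k ≤ 1 := h2.trans ((min_le_right _ _).trans (min_le_right _ _))
    have h3 := h1 (k + 1) (Nat.le_succ k) (by rw [hstep]; linarith)
    rw [hstep] at h3
    have h4 := hspeed (x k) (hC k) 0 ⟨le_rfl, by linarith⟩ (aggStep α Y k) ⟨ha0, by linarith⟩
    rw [flow_zero, sub_zero, abs_of_nonneg ha0] at h4
    have h5 : V * aggStep α Y k ≤ η := by
      have := h2.trans (min_le_left _ _)
      rw [le_div_iff₀ (by positivity)] at this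
      nlinarith
    have := norm_sub_le_norm_sub_add_norm_sub (x (k + 1)) (flow f hf (x k) (aggStep α Y k)) (x k)
    linarith
  filter_upwards [eventually_ge_atTop (aggTime α Y K)] with τ hτ s hs
  have hτ0 : 0 ≤ τ := (aggTime_nonneg hα.pos hY.nonempty K).trans hτ
  have hsT : s ≤ T := hs.2.trans (le_abs_self _)
  obtain ⟨hn1, hn2⟩ := segmentIndex_spec ht hτ0
  obtain ⟨hk1, hk2⟩ := segmentIndex_spec ht (show 0 ≤ τ + s by linarith [hs.1])
  set n := segmentIndex α Y τ
  set k := segmentIndex α Y (τ + s)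
  have hKn : K ≤ n := by
    have := hmono.lt_iff_lt.mp (hτ.trans_lt hn2)
    omega
  have hnk : n ≤ k := by
    have := hmono.lt_iff_lt.mp ((hn1.trans (by linarith [hs.1] : τ ≤ τ + s)).trans_lt hk2)
    omega
  have han : aggStep α Y n ≤ η ∧ aggStep α Y n ≤ 1 :=
    le_min_iff.mp ((hK n hKn).2.trans (min_le_right _ _))
  have hak : aggStep α Y k ≤ η ∧ aggStep α Y k ≤ 1 :=
    le_min_iff.mp ((hK k (hKn.trans hnk)).2.trans (min_le_right _ _))
  rw [aggTime_succ] at hn2 hk2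
  have h1 : ‖interp α Y x (τ + s) - x k‖ ≤ 2 * η :=
    (norm_interp_sub_le hα.pos hY.nonempty ht ⟨hk1, by rw [aggTime_succ]; exact hk2.le⟩).trans
      (hinc k (hKn.trans hnk))
  have h2 : ‖interp α Y x τ - x n‖ ≤ 2 * η :=
    (norm_interp_sub_le hα.pos hY.nonempty ht ⟨hn1, by rw [aggTime_succ]; exact hn2.le⟩).trans
      (hinc n hKn)
  have hkn0 : 0 ≤ aggTime α Y k - aggTime α Y n := sub_nonneg.mpr (hmono.monotone hnk)
  have hknT : aggTime α Y k - aggTime α Y n ≤ T + 1 := by linarith [han.2]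
  have h3 := (hK n hKn).1 k hnk hknT
  have h4 := hspeed (x n) (hC n) s ⟨hs.1, by linarith⟩ _ ⟨hkn0, hknT⟩
  -- Rounding `τ` and `τ + s` down to grid times causes offsets of opposite sign, each at most one
  -- step.
  have h5 : |aggTime α Y k - aggTime α Y n - s| ≤ η := by
    rw [abs_le]
    constructor <;> linarith [han.1, hak.1]
  have h6 := norm_flow_sub_flow_le hf hL (x n) (interp α Y x τ) s
  have h7 : ‖x n - interp α Y x τ‖ * Real.exp (L * |s|) ≤ 2 * η * e := by
    rw [norm_sub_rev]
    refine mul_le_mul h2 ?_ (by positivity) (by positivity)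
    rw [abs_of_nonneg hs.1]
    exact Real.exp_le_exp.mpr (mul_le_mul_of_nonneg_left hsT L.coe_nonneg)
  have h8 : V * |aggTime α Y k - aggTime α Y n - s| ≤ V * η := by gcongr
  have t1 := norm_sub_le_norm_sub_add_norm_sub (interp α Y x (τ + s)) (x k)
    (flow f hf (interp α Y x τ) s)
  have t2 := norm_sub_le_norm_sub_add_norm_sub (x k)
    (flow f hf (x n) (aggTime α Y k - aggTime α Y n)) (flow f hf (interp α Y x τ) s)
  have t3 := norm_sub_le_norm_sub_add_norm_sub
    (flow f hf (x n) (aggTime α Y k - aggTime α Y n)) (flow f hf (x n) s)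
    (flow f hf (interp α Y x τ) s)
  have hfin : 2 * η * (2 + V + e) = θ := by rw [hη]; field_simp
  nlinarith

/-- Convergence to an internally chain transitive set along a sample path with bounded iterates. -/
theorem exists_limitSet_of_bounded (hd : 0 < d) (hh : ∃ L, LipschitzWith L h)
    (hα : StepsizeConditions α) (hY : RegularUpdates α Y)
    (hx : ∀ n i, x (n + 1) i = x n i +
      compStep α Y n i * (h (x n) i + M (n + 1) i + ε (n + 1) i))
    (hδ : Tendsto δ atTop (𝓝 0)) (hε : ∀ n, ‖ε (n + 1)‖ ≤ δ (n + 1) * (1 + ‖x n‖))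
    (hnoise : ∀ i, ∃ l, Tendsto (fun n => ∑ k ∈ Finset.range n,
      compStep α Y k i * M (k + 1) i) atTop (𝓝 l))
    (hC : ∀ n, ‖x n‖ ≤ C) :
    ∃ D : Set (Fin d → ℝ),
      (IsCompact D ∧ IsConnected D ∧ IsInternallyChainTransitive h D ∧
        IsInvariantSet h D ∧ Tendsto (fun n => Metric.infDist (x n) D) atTop (𝓝 0)) ∧
      ∃ X : C(ℝ, Fin d → ℝ), (∀ t, X t = interp α Y x t) ∧
        IsCompact (closure (range (shift X))) ∧
        ∀ z : C(ℝ, Fin d → ℝ), MapClusterPt z atTop (shift X) →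
          IsIntegralCurve z (fun _ y => (1 / (d : ℝ)) • h y) ∧ ∀ t, z t ∈ D := by
  have hdR : (0 : ℝ) < d := by exact_mod_cast hd
  have hf : ∃ L, LipschitzWith L fun y => (1 / (d : ℝ)) • h y := by
    obtain ⟨L, hL⟩ := hh
    exact ⟨_, (lipschitzWith_smul (1 / (d : ℝ))).comp hL⟩
  have ht := hY.tendsto_aggTime hα
  have hcont : Continuous (interp α Y x) := continuous_interp hα.pos hY.nonempty ht
  have hbd : ∀ t, ‖interp α Y x t‖ ≤ C := norm_interp_le hα.pos hY.nonempty ht hC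
  have hapt := isAsymptoticPseudotrajectory_interp hd hh hf hα hY hx hδ hε hnoise hC
  -- The flows of `h` and `h / d` have the same orbits up to a change of speed, so invariance and
  -- chains transfer; the minimal jump time is scaled by `d`.
  have hflow : ∀ p t, flow h hh p t = flow (fun y => (1 / (d : ℝ)) • h y) hf p (t * d) := by
    intro p t
    rw [flow_smul_eq hh hf]
    congr 1
    field_simp
  set X : C(ℝ, Fin d → ℝ) := ⟨interp α Y x, hcont⟩ with hX
  refine ⟨limitSet (interp α Y x), ⟨isCompact_limitSet hbd, isConnected_limitSet hbd hcont, ?_, ?_,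
    ?_⟩, X, fun t => rfl, ?_, ?_⟩
  · intro a ha b hb θ hθ T hT
    obtain ⟨n, hn, p, h0, hpn, hD, hstep⟩ := hapt.exists_chain hbd ha hb hθ
      (T := T * d) (by positivity)
    refine ⟨n, hn, p, h0, hpn, hD, fun i hi => ?_⟩
    obtain ⟨t, htT, hlt⟩ := hstep i hi
    refine ⟨flow h hh (p i), isIntegralCurve_flow hh _, flow_zero hh _, t / d,
      (le_div_iff₀ hdR).mpr htT, ?_⟩
    rwa [hflow, div_mul_cancel₀ _ hdR.ne']
  · intro z hz hz0 t
    rw [eq_flow hh hz, hflow]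
    exact hapt.flow_mem_limitSet hz0 _
  · refine ((tendsto_infDist_limitSet hbd).comp ht).congr fun n => ?_
    simp [interp_aggTime hα.pos hY.nonempty ht]
  · refine isCompact_closure_range_shift (X := X) hbd (hapt.uniformContinuous hbd hcont ?_)
    intro t ht0
    change interp α Y x t = interp α Y x 0
    rw [interp_of_nonpos hα.pos hY.nonempty ht ht0,
      interp_of_nonpos hα.pos hY.nonempty ht le_rfl]
  · intro z hz
    have hzflow : (z : ℝ → Fin d → ℝ) = flow (fun y => (1 / (d : ℝ)) • h y) hf (z 0) :=
      funext fun s => IsAsymptoticPseudotrajectory.eq_flow_of_mapClusterPt_shift (X := X) hapt hz s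
    refine ⟨?_, fun t => IsAsymptoticPseudotrajectory.mem_limitSet_of_mapClusterPt_shift hz t⟩
    rw [hzflow]
    exact isIntegralCurve_flow hf (z 0)

end Path

end AsyncSA
end

noncomputable section

namespace AsyncSA

/-! ### Measurability of the stepsizes and the normalizers -/

section Measurability

variable {Ω : Type*} {m0 : MeasurableSpace Ω} {d : ℕ} {ℱ : Filtration ℕ m0}
  {Y : ℕ → Ω → Finset (Fin d)} {x : ℕ → Ω → Fin d → ℝ}

lemma measurable_updateCount (hY : ∀ n i, MeasurableSet[ℱ n] {ω | i ∈ Y n ω}) (n : ℕ)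
    (i : Fin d) : Measurable[ℱ n] fun ω => updateCount (fun k => Y k ω) n i := by
  induction n with
  | zero => simp [updateCount]
  | succ n ih =>
    simp only [updateCount_succ]
    exact (ih.mono (ℱ.mono n.le_succ) le_rfl).add
      (Measurable.ite (ℱ.mono n.le_succ _ (hY n i)) measurable_const measurable_const)

lemma adapted_compStep (α : ℕ → ℝ) (hY : ∀ n i, MeasurableSet[ℱ n] {ω | i ∈ Y n ω})
    (i : Fin d) : Adapted ℱ fun n ω => compStep α (fun k => Y k ω) n i := by
  intro n
  exact Measurable.ite (hY n i) ((measurable_of_countable α).comp (measurable_updateCount hY n i))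
    measurable_const

lemma adapted_aggStep (α : ℕ → ℝ) (hY : ∀ n i, MeasurableSet[ℱ n] {ω | i ∈ Y n ω}) :
    Adapted ℱ fun n ω => aggStep α (fun k => Y k ω) n := by
  intro n
  simp only [aggStep_eq]
  exact Finset.measurable_sum _ fun i _ => adapted_compStep α hY i n

lemma measurable_normState (R T : ℝ) {a : ℕ → Ω → ℝ} (ha : Adapted ℱ a) (hx : Adapted ℱ x)
    (n : ℕ) : Measurable[ℱ n] fun ω => normState R T (fun k => a k ω) (fun k => x k ω) n := by
  induction n with
  | zero => exact measurable_const.prodMk (measurable_const.max (measurable_norm.comp (hx 0)))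
  | succ n ih =>
    simp only [normState]
    have ih' := ih.mono (ℱ.mono n.le_succ) le_rfl
    have ha' := (ha n).mono (ℱ.mono n.le_succ) le_rfl
    refine Measurable.ite (measurableSet_le measurable_const (ih'.fst.add ha'))
      (measurable_const.prodMk (measurable_const.max (measurable_norm.comp (hx (n + 1)))))
      ((ih'.fst.add ha').prodMk ih'.snd)

lemma adapted_normWeight (R T B : ℝ) {a : ℕ → Ω → ℝ} (ha : Adapted ℱ a) (hx : Adapted ℱ x) :
    Adapted ℱ fun n ω => normWeight R T B (fun k => a k ω) (fun k => x k ω) n := by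
  intro n
  have h := (measurable_normState R T ha hx n).snd
  exact Measurable.ite (measurableSet_le (measurable_norm.comp (hx n)) (h.const_mul B)) h.inv measurable_const

end Measurability

/-! ### Almost sure boundedness and convergence of the noise sums -/

section Main

variable {Ω : Type*} {m0 : MeasurableSpace Ω} {μ : Measure Ω} {d : ℕ}
  {ℱ : Filtration ℕ m0} {h : (Fin d → ℝ) → (Fin d → ℝ)} {α : ℕ → ℝ}
  {Y : ℕ → Ω → Finset (Fin d)} {x M ε : ℕ → Ω → Fin d → ℝ}

lemma IsAsyncSA.recursion (halg : IsAsyncSA ℱ h α Y x M ε) (ω : Ω) (n : ℕ) (i : Fin d) :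
    x (n + 1) ω i = x n ω i + compStep α (fun k => Y k ω) n i *
      (h (x n ω) i + M (n + 1) ω i + ε (n + 1) ω i) := by
  unfold compStep
  split_ifs with hi
  · exact halg.update n ω i hi
  · rw [halg.no_update n ω i hi]; ring

/-- The exceptional set of the balance condition depends on the window length; the countably many
lengths `1 / (p + 1)` leave a single null set. -/
lemma IsAsyncSA.ae_regularUpdates (halg : IsAsyncSA ℱ h α Y x M ε)
    (hupd : UpdateConditions μ α Y) : ∀ᵐ ω ∂μ, RegularUpdates α fun n => Y n ω := by
  obtain ⟨Δ, hΔ, hfreq⟩ := hupd.frequency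
  have hbal : ∀ᵐ ω ∂μ, ∀ p : ℕ, ∀ i j : Fin d, _ := ae_all_iff.mpr fun p : ℕ =>
    ae_all_iff.mpr fun i => ae_all_iff.mpr fun j =>
      hupd.balance (1 / ((p : ℝ) + 1)) (by positivity) i j
  filter_upwards [ae_all_iff.mpr hfreq, hbal] with ω h1 h2
  exact ⟨fun n => halg.nonempty n ω, ⟨Δ, hΔ, h1⟩, h2⟩

variable [IsProbabilityMeasure μ]

/-- Almost sure convergence of the noise sums, for weights that keep the conditional variances
bounded. -/
lemma ae_exists_tendsto_weighted_noise (halg : IsAsyncSA ℱ h α Y x M ε)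
    (hint : ∀ n, Integrable (M (n + 1)) μ) (hcent : ∀ n, μ[M (n + 1) | ℱ n] =ᵐ[μ] 0)
    {v w : ℕ → Ω → ℝ} (hv : Adapted ℱ v) (hw : Adapted ℱ w)
    (hvar : ∀ n, ∀ᵐ ω ∂μ, condLExp (ℱ n) μ (fun ω' => ENNReal.ofReal (‖M (n + 1) ω'‖ ^ 2)) ω ≤
      ENNReal.ofReal (v n ω))
    (hα : Summable fun n => α n ^ 2) (hw1 : ∀ n ω, |w n ω| ≤ 1)
    (hbdd : ∀ᵐ ω ∂μ, BddAbove (range fun n => w n ω ^ 2 * v n ω)) :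
    ∀ᵐ ω ∂μ, ∀ i, ∃ l, Tendsto (fun n => ∑ k ∈ Finset.range n,
      compStep α (fun k => Y k ω) k i * w k ω * M (k + 1) ω i) atTop (𝓝 l) := by
  refine ae_all_iff.mpr fun i => ?_
  refine ae_exists_tendsto_sum_mul_noise (ℱ := ℱ) (A := ∑' k, α k ^ 2) (B := 1)
    (ξ := fun n ω => M (n + 1) ω i) (adapted_compStep α halg.adapted_Y i) hw hv
    (fun n => (measurable_pi_apply i).comp (halg.adapted_M (n + 1)))
    (fun n => (ContinuousLinearMap.proj (R := ℝ) (φ := fun _ : Fin d => ℝ) i).integrable_comp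
      (hint n))
    (fun n => ?_) (fun n => ?_) (fun n ω => sum_compStep_sq_le hα n i) hw1 hbdd
  · have h1 := (ContinuousLinearMap.proj (R := ℝ) (φ := fun _ : Fin d => ℝ) i).comp_condExp_comm
      (m := ℱ n) (hint n)
    filter_upwards [h1, hcent n] with ω h2 h3
    simp only [Function.comp_def, ContinuousLinearMap.proj_apply] at h2
    rw [← h2, h3]
    rfl
  · have hmono : (fun ω' => ENNReal.ofReal (M (n + 1) ω' i ^ 2)) ≤ᵐ[μ]
        fun ω' => ENNReal.ofReal (‖M (n + 1) ω'‖ ^ 2) :=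
      Eventually.of_forall fun ω => ENNReal.ofReal_le_ofReal (by
        rw [← sq_abs]
        have := norm_le_pi_norm (M (n + 1) ω) i
        rw [Real.norm_eq_abs] at this
        gcongr)
    filter_upwards [condLExp_mono (mΩ := ℱ n) hmono, hvar n] with ω h1 h2
    exact h1.trans h2

/-- The iterates of the asynchronous algorithm are almost surely bounded. -/
theorem ae_bounded (hd : 0 < d) (halg : IsAsyncSA ℱ h α Y x M ε) (hdrift : DriftConditions h)
    (hnoise : NoiseConditions μ ℱ x M ε) (hstep : StepsizeConditions α)
    (hupd : UpdateConditions μ α Y) : ∀ᵐ ω ∂μ, ∃ C, ∀ n, ‖x n ω‖ ≤ C := by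
  obtain ⟨R, T, B, hR, hB, hbound⟩ := exists_normalization hd hdrift
  obtain ⟨K, hKad, hK0, hKb, hKvar⟩ := hnoise.variance
  obtain ⟨δ, -, hδ, hε⟩ := hnoise.bias
  have hv : Adapted ℱ fun n ω => K n ω * (1 + ‖x n ω‖ ^ 2) := fun n =>
    (hKad n).mul (measurable_const.add ((measurable_norm.comp (halg.adapted_x n)).pow_const 2))
  have hw := adapted_normWeight R T B (adapted_aggStep α halg.adapted_Y) halg.adapted_x
  have hρ : ∀ (ω : Ω) n, 1 ≤
      (normState R T (aggStep α fun k => Y k ω) (fun k => x k ω) n).2 := fun ω n =>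
    hR.trans (le_normState_snd n)
  have hconv := ae_exists_tendsto_weighted_noise halg hnoise.integrable hnoise.centered hv hw hKvar
    hstep.summable_sq (fun n ω => ?_) ?_
  · filter_upwards [hconv, halg.ae_regularUpdates hupd, hδ, ae_all_iff.mpr hε] with ω h1 h2 h3 h4
    exact hbound α (fun n => Y n ω) (fun n => x n ω) (fun n => M n ω) (fun n => ε n ω)
      (fun n => δ n ω) hstep h2 (halg.recursion ω) h3 h4 h1
  · simp only [normWeight]
    have h1 := hρ ω n
    split_ifs
    · rw [abs_inv, abs_of_pos (by linarith)]
      exact inv_le_one_of_one_le₀ h1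
    · simp
  · filter_upwards [hKb] with ω hω
    obtain ⟨A, hA⟩ := hω
    refine ⟨A * (1 + B ^ 2), ?_⟩
    rintro _ ⟨n, rfl⟩
    have h1 := hρ ω n
    have hAn : K n ω ≤ A := hA ⟨n, rfl⟩
    have hA0 : 0 ≤ A := (hK0 n ω).trans hAn
    simp only [normWeight]
    set ρ := (normState R T (aggStep α fun k => Y k ω) (fun k => x k ω) n).2 with hρdef
    have hρ0 : 0 < ρ := by linarith
    split_ifs with hif
    -- Where the weight is nonzero, `‖x‖ ≤ B ρ` and `ρ ≥ 1`, so `ρ⁻²` cancels the quadratic growth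
    -- of the variance without any prior bound on the iterates.
    · have h2 : 1 + ‖x n ω‖ ^ 2 ≤ ρ ^ 2 * (1 + B ^ 2) := by
        have h3 : ‖x n ω‖ ^ 2 ≤ (B * ρ) ^ 2 := by gcongr
        nlinarith
      calc ρ⁻¹ ^ 2 * (K n ω * (1 + ‖x n ω‖ ^ 2))
          ≤ ρ⁻¹ ^ 2 * (A * (ρ ^ 2 * (1 + B ^ 2))) := by gcongr
        _ = A * (1 + B ^ 2) := by field_simp
    · simp; positivity

/-- Along bounded iterates `K_n (1 + ‖x_n‖²)` is bounded, so the constant weight `1` suffices. -/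
theorem ae_exists_tendsto_noise (halg : IsAsyncSA ℱ h α Y x M ε)
    (hnoise : NoiseConditions μ ℱ x M ε) (hstep : StepsizeConditions α)
    (hbdd : ∀ᵐ ω ∂μ, ∃ C, ∀ n, ‖x n ω‖ ≤ C) :
    ∀ᵐ ω ∂μ, ∀ i, ∃ l, Tendsto (fun n => ∑ k ∈ Finset.range n,
      compStep α (fun k => Y k ω) k i * M (k + 1) ω i) atTop (𝓝 l) := by
  obtain ⟨K, hKad, hK0, hKb, hKvar⟩ := hnoise.variance
  have hv : Adapted ℱ fun n ω => K n ω * (1 + ‖x n ω‖ ^ 2) := fun n =>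
    (hKad n).mul (measurable_const.add ((measurable_norm.comp (halg.adapted_x n)).pow_const 2))
  have hvb : ∀ᵐ ω ∂μ, BddAbove
      (range fun n => (1 : ℝ) ^ 2 * (K n ω * (1 + ‖x n ω‖ ^ 2))) := by
    filter_upwards [hKb, hbdd] with ω hω hC
    obtain ⟨A, hA⟩ := hω
    obtain ⟨C, hC⟩ := hC
    refine ⟨A * (1 + C ^ 2), ?_⟩
    rintro _ ⟨n, rfl⟩
    have hAn : K n ω ≤ A := hA ⟨n, rfl⟩
    have hA0 : 0 ≤ A := (hK0 n ω).trans hAn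
    have hCn := hC n
    simp only [one_pow, one_mul]
    gcongr
  have hconv := ae_exists_tendsto_weighted_noise halg hnoise.integrable hnoise.centered hv
    (w := fun _ _ => 1) (fun _ => measurable_const) hKvar hstep.summable_sq (by simp) hvb
  simpa only [mul_one] using hconv

end Main

end AsyncSA
end
theorem mainTheorem2 {Ω : Type*} {m0 : MeasurableSpace Ω} (μ : Measure Ω) [IsProbabilityMeasure μ]
    {d : ℕ} (ℱ : Filtration ℕ m0) (h : (Fin d → ℝ) → (Fin d → ℝ)) (α : ℕ → ℝ)
    (Y : ℕ → Ω → Finset (Fin d)) (x M ε : ℕ → Ω → Fin d → ℝ)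
    (halg : AsyncSA.IsAsyncSA ℱ h α Y x M ε)
    (hdrift : AsyncSA.DriftConditions h)
    (hnoise : AsyncSA.NoiseConditions μ ℱ x M ε)
    (hstep : AsyncSA.StepsizeConditions α)
    (hupd : AsyncSA.UpdateConditions μ α Y) :
    ∀ᵐ ω ∂μ, ∃ D : Set (Fin d → ℝ),
      -- (i) the iterates converge to `D`
      (IsCompact D ∧ IsConnected D ∧ AsyncSA.IsInternallyChainTransitive h D ∧
        AsyncSA.IsInvariantSet h D ∧
        Tendsto (fun n => Metric.infDist (x n ω) D) atTop (𝓝 0)) ∧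
      -- (ii) the interpolated trajectory is continuous, and its shifts are relatively compact
      -- with all limit points as `t → ∞` being solutions of `ẋ = (1/d) h(x)` inside `D`
      ∃ X : C(ℝ, Fin d → ℝ),
        (∀ t, X t = AsyncSA.interp α (fun n => Y n ω) (fun n => x n ω) t) ∧
        IsCompact (closure (range (AsyncSA.shift X))) ∧
        ∀ z : C(ℝ, Fin d → ℝ), MapClusterPt z atTop (AsyncSA.shift X) →
          IsIntegralCurve z (fun _ y => (1 / (d : ℝ)) • h y) ∧ ∀ t, z t ∈ D := by
  obtain ⟨ω₀⟩ := nonempty_of_isProbabilityMeasure μ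
  -- The nonempty set of updated components contains an index, so `d ≥ 1`.
  have hd : 0 < d := (halg.nonempty 0 ω₀).choose.pos
  obtain ⟨δ, -, hδ, hε⟩ := hnoise.bias
  have hbdd := AsyncSA.ae_bounded hd halg hdrift hnoise hstep hupd
  have hconv := AsyncSA.ae_exists_tendsto_noise halg hnoise hstep hbdd
  filter_upwards [hbdd, hconv, halg.ae_regularUpdates hupd, hδ, ae_all_iff.mpr hε]
    with ω hω h1 h2 h3 h4
  obtain ⟨C, hC⟩ := hω
  exact AsyncSA.exists_limitSet_of_bounded (M := fun n => M n ω) (ε := fun n => ε n ω)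
    (δ := fun n => δ n ω) hd hdrift.lipschitz hstep h2 (halg.recursion ω) h3 h4 h1 hC
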